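/- Let $\Bbbk$ be a field of arbitrary characteristic. An \emph{operadic Lie superalgebra} over $\Bbbk$ is a super vector space $\mathfrak g=\mathfrak g_0\oplus\mathfrak g_1$ (of any dimension) with an even bilinear bracket such that, for homogeneous $x,y,z$, $$[x,y]+(-1)^{|x||y|}[y,x]=0,\qquad [[x,y],z]+(-1)^{|x|(|y|+|z|)}[[y,z],x]+(-1)^{|z|(|x|+|y|)}[[z,x],y]=0;$$ no further identity is imposed in characteristic $2$ or $3$. Its enveloping algebra $U(\mathfrak g)$ is the quotient of the tensor algebra $T(\mathfrak g)$ by the elements $x\otimes y-(-1)^{|x||y|}y\otimes x-[x,y]$, and its symmetric algebra $S(\mathfrak g)$ is the quotient of $T(\mathfrak g)$ by the elements $x\otimes y-(-1)^{|x||y|}y\otimes x$ ($x,y\in\mathfrak g$ homogeneous). Let $U_n\subseteq U(\mathfrak g)$ be the span of the products of at most $n$ elements of the image of $\mathfrak g$, $U_{-1}=0$, and $\operatorname{gr}U(\mathfrak g)=\bigoplus_{n\ge 0}U_n/U_{n-1}$. Let $A=(a_{ij})\in\Bbbk^{\theta\times\theta}$, let $(|i|)_{1\le i\le\theta}$ be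 parities in $\mathbb Z/2$, written as the vector $\mathbf p=((-1)^{|i|})_i$, let $\mathfrak h$ be a $\Bbbk$-vector space of dimension $2\theta-\operatorname{rank}A$, and let $(h_i)$ in $\mathfrak h$ and $(\xi_i)$ in $\mathfrak h^*$ be linearly independent families, indexed by $1\le i\le\theta$, with $\xi_j(h_i)=a_{ij}$ for all $i,j$. Let $\widetilde{\mathfrak g}(A,\mathbf p)$ be the operadic Lie superalgebra presented by generators $e_i,f_i$ of parity $|i|$ and $\mathfrak h$ (even), with the relations $$[h,h']=0,\quad [h,e_i]=\xi_i(h)e_i,\quad [h,f_i]=-\xi_i(h)f_i,\quad [e_i,f_j]=\delta_{ij}h_i ,$$ graded by $\mathbb Z$ with $\deg e_i=1$, $\deg f_i=-1$, $\deg h=0$, and let $\mathfrak g(A,\mathbf p)=\widetilde{\mathfrak g}(A,\mathbf p)/\mathfrak r$ be the contragredient Lie superalgebra, where $\mathfrak r$ is the largest $\mathbb Z$-homogeneous ideal with $\mathfrak r\cap\mathfrak h=0$ (the sum of all such ideals). \textbf{Lemma.} For every contragredient Lie superalgebra $\mathfrak g=\mathfrak g(A,\mathbf p)$, in every characteristic,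 the natural algebra map $\eta\colon S(\mathfrak g)\to\operatorname{gr}U(\mathfrak g)$, $x\mapsto x+U_0\in U_1/U_0$ for $x\in\mathfrak g$, is an isomorphism. -/

import Mathlib

universe u v w

noncomputable section

/-! ## Operadic Lie superalgebras -/

/-- The Koszul sign `(-1)^{ab}` for parities `a b : ℤ/2`. -/
def koszulSign (k : Type u) [Field k] (a b : ZMod 2) : k :=
  if a = 1 ∧ b = 1 then -1 else 1

/-- A super vector space `L = L₀ ⊕ L₁` over `k` (of any dimension) with an even bilinear product,
written as a bracket. No identity is imposed on the product. -/
structure BracketSuperalgebra (k : Type u) (L : Type v) [Field k] [AddCommGroup L]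
    [Module k L] where
  grading : ZMod 2 → Submodule k L
  isCompl_grading : IsCompl (grading 0) (grading 1)
  bracket : L →ₗ[k] L →ₗ[k] L
  bracket_mem : ∀ (a b : ZMod 2) (x y : L), x ∈ grading a → y ∈ grading b →
    bracket x y ∈ grading (a + b)

/-- An operadic Lie superalgebra over `k`: an operadic Lie algebra in super vector spaces. Only
super antisymmetry `b ∘ (id + c) = 0` and the super Jacobi identity
`b ∘ (b ⊗ id) ∘ (id + (123) + (132)) = 0` are imposed, in every characteristic; neither
`[x, x] = 0` for even `x` nor `[x, [x, x]] = 0` for odd `x` is part of the definition. -/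
structure OperadicLieSuperalgebra (k : Type u) (L : Type v) [Field k] [AddCommGroup L]
    [Module k L] extends BracketSuperalgebra k L where
  skew : ∀ (a b : ZMod 2) (x y : L), x ∈ grading a → y ∈ grading b →
    bracket x y + koszulSign k a b • bracket y x = 0
  jacobi : ∀ (a b c : ZMod 2) (x y z : L), x ∈ grading a → y ∈ grading b → z ∈ grading c →
    bracket (bracket x y) z + koszulSign k a (b + c) • bracket (bracket y z) x
      + koszulSign k c (a + b) • bracket (bracket z x) y = 0

namespace BracketSuperalgebra

variable {k : Type u} {L : Type v} [Field k] [AddCommGroup L] [Module k L]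

/-- Two-sided ideals that are subobjects in super vector spaces. -/
structure IsSuperIdeal (B : BracketSuperalgebra k L) (I : Submodule k L) : Prop where
  bracket_right : ∀ x y, y ∈ I → B.bracket x y ∈ I
  bracket_left : ∀ x y, y ∈ I → B.bracket y x ∈ I
  homogeneous : I ≤ (I ⊓ B.grading 0) ⊔ (I ⊓ B.grading 1)

theorem isSuperIdeal_sSup (B : BracketSuperalgebra k L) (S : Set (Submodule k L))
    (hS : ∀ I ∈ S, B.IsSuperIdeal I) : B.IsSuperIdeal (sSup S) where
  bracket_right x y hy := by
    have : sSup S ≤ (sSup S).comap (B.bracket x) :=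
      sSup_le fun I hI z hz => le_sSup hI ((hS I hI).bracket_right x z hz)
    exact this hy
  bracket_left x y hy := by
    have : sSup S ≤ (sSup S).comap (B.bracket.flip x) :=
      sSup_le fun I hI z hz => le_sSup hI ((hS I hI).bracket_left x z hz)
    exact this hy
  homogeneous := sSup_le fun I hI => (hS I hI).homogeneous.trans <|
    sup_le_sup (inf_le_inf_right _ (le_sSup hI)) (inf_le_inf_right _ (le_sSup hI))

/-- The product induced on the quotient by a two-sided ideal. -/
def quotientBracket (B : BracketSuperalgebra k L) (I : Submodule k L) (hI : B.IsSuperIdeal I) :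
    (L ⧸ I) →ₗ[k] (L ⧸ I) →ₗ[k] (L ⧸ I) :=
  I.liftQ
    { toFun := fun x => I.mapQ I (B.bracket x) (fun y hy => hI.bracket_right x y hy)
      map_add' := fun x y => by
        apply LinearMap.ext; intro z
        obtain ⟨z, rfl⟩ := I.mkQ_surjective z
        simp
      map_smul' := fun c x => by
        apply LinearMap.ext; intro z
        obtain ⟨z, rfl⟩ := I.mkQ_surjective z
        simp }
    (fun x hx => by
      apply LinearMap.ext; intro z
      obtain ⟨z, rfl⟩ := I.mkQ_surjective z
      simpa using hI.bracket_left z x hx)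

@[simp]
theorem quotientBracket_mk (B : BracketSuperalgebra k L) (I : Submodule k L)
    (hI : B.IsSuperIdeal I) (x y : L) :
    B.quotientBracket I hI (I.mkQ x) (I.mkQ y) = I.mkQ (B.bracket x y) := rfl

/-- The quotient of a super vector space with product by a two-sided super ideal. -/
def quotient (B : BracketSuperalgebra k L) (I : Submodule k L) (hI : B.IsSuperIdeal I) :
    BracketSuperalgebra k (L ⧸ I) where
  grading a := (B.grading a).map I.mkQ
  isCompl_grading := by
    constructor
    · rw [Submodule.disjoint_def]
      rintro _ ⟨x, hx, rfl⟩ ⟨y, hy, hxy⟩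
      have h1 : x - y ∈ I := by
        rw [← Submodule.Quotient.mk_eq_zero, Submodule.Quotient.mk_sub, sub_eq_zero]
        exact hxy.symm
      obtain ⟨s, hs, t, ht, hst⟩ := Submodule.mem_sup.1 (hI.homogeneous h1)
      have h2 : x - s = y + t := by
        have : x - y - s - t = 0 := by rw [← hst]; abel
        rw [← sub_eq_zero, ← this]; abel
      have h3 : x - s = 0 := Submodule.disjoint_def.1 B.isCompl_grading.disjoint _
        (sub_mem hx hs.2) (h2 ▸ add_mem hy ht.2)
      rw [sub_eq_zero] at h3
      subst h3
      simpa using hs.1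
    · rw [codisjoint_iff, ← Submodule.map_sup, B.isCompl_grading.sup_eq_top, Submodule.map_top,
        Submodule.range_mkQ]
  bracket := B.quotientBracket I hI
  bracket_mem := by
    rintro a b _ _ ⟨x, hx, rfl⟩ ⟨y, hy, rfl⟩
    exact ⟨_, B.bracket_mem a b x y hx hy, rfl⟩

end BracketSuperalgebra

namespace OperadicLieSuperalgebra

variable {k : Type u} {L : Type v} [Field k] [AddCommGroup L] [Module k L]

/-- The quotient of a super vector space with product by a two-sided super ideal that contains all
the defects of super antisymmetry and of the super Jacobi identity. -/
def ofQuotient (B : BracketSuperalgebra k L) (I : Submodule k L) (hI : B.IsSuperIdeal I)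
    (hskew : ∀ (a b : ZMod 2) (x y : L), x ∈ B.grading a → y ∈ B.grading b →
      B.bracket x y + koszulSign k a b • B.bracket y x ∈ I)
    (hjacobi : ∀ (a b c : ZMod 2) (x y z : L), x ∈ B.grading a → y ∈ B.grading b →
      z ∈ B.grading c → B.bracket (B.bracket x y) z
        + koszulSign k a (b + c) • B.bracket (B.bracket y z) x
        + koszulSign k c (a + b) • B.bracket (B.bracket z x) y ∈ I) :
    OperadicLieSuperalgebra k (L ⧸ I) where
  toBracketSuperalgebra := B.quotient I hI
  skew := by
    rintro a b _ _ ⟨x, hx, rfl⟩ ⟨y, hy, rfl⟩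
    rw [← (Submodule.Quotient.mk_eq_zero I).2 (hskew a b x y hx hy)]
    rfl
  jacobi := by
    rintro a b c _ _ _ ⟨x, hx, rfl⟩ ⟨y, hy, rfl⟩ ⟨z, hz, rfl⟩
    rw [← (Submodule.Quotient.mk_eq_zero I).2 (hjacobi a b c x y z hx hy hz)]
    rfl

/-- The quotient of an operadic Lie superalgebra by a two-sided super ideal. -/
def quotient (B : OperadicLieSuperalgebra k L) (I : Submodule k L)
    (hI : B.toBracketSuperalgebra.IsSuperIdeal I) : OperadicLieSuperalgebra k (L ⧸ I) :=
  ofQuotient B.toBracketSuperalgebra I hI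
    (fun a b x y hx hy => by rw [B.skew a b x y hx hy]; exact zero_mem I)
    (fun a b c x y z hx hy hz => by rw [B.jacobi a b c x y z hx hy hz]; exact zero_mem I)

end OperadicLieSuperalgebra

/-! ## The associated graded algebra of a generated filtration -/

namespace GeneratedFiltration

open scoped DirectSum

variable {k : Type u} {U : Type v} [Field k] [Ring U] [Algebra k U] (V : Submodule k U)

/-- The span of the products of at most `n` elements of `V` (for `n = 0`, the scalars). -/
def filt (n : ℕ) : Submodule k U := (1 ⊔ V) ^ n

/-- The preceding step of the filtration, with step `-1` equal to `0`. -/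
def filtPred : ℕ → Submodule k U
  | 0 => ⊥
  | n + 1 => filt V n

variable {V}

theorem filt_mono_succ (n : ℕ) : filt V n ≤ filt V (n + 1) := by
  intro x hx
  have h : x * 1 ∈ (1 ⊔ V) ^ n * (1 ⊔ V) :=
    Submodule.mul_mem_mul hx (Submodule.mem_sup_left (Submodule.one_le.1 le_rfl))
  simpa [filt, pow_succ] using h

theorem filt_mul_mem {i j : ℕ} {x y : U} (hx : x ∈ filt V i) (hy : y ∈ filt V j) :
    x * y ∈ filt V (i + j) := by
  rw [filt, pow_add]; exact Submodule.mul_mem_mul hx hy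

theorem filt_mul_pred {i j : ℕ} {x y : U} (hx : x ∈ filt V i) (hy : y ∈ filtPred V j) :
    x * y ∈ filtPred V (i + j) := by
  cases j with
  | zero => rw [(Submodule.mem_bot k).1 hy, mul_zero]; exact zero_mem _
  | succ j => exact filt_mul_mem hx hy

theorem filtPred_mul {i j : ℕ} {x y : U} (hx : x ∈ filtPred V i) (hy : y ∈ filt V j) :
    x * y ∈ filtPred V (i + j) := by
  cases i with
  | zero => rw [(Submodule.mem_bot k).1 hx, zero_mul]; exact zero_mem _
  | succ i => rw [Nat.succ_add]; exact filt_mul_mem (V := V) hx hy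

theorem one_mem_filt : (1 : U) ∈ filt V 0 := by
  rw [filt, pow_zero]; exact Submodule.one_le.1 le_rfl

theorem natCast_mem_filt (n : ℕ) : (n : U) ∈ filt V 0 := by
  simpa [Algebra.smul_def] using (filt V 0).smul_mem (n : k) one_mem_filt

theorem intCast_mem_filt (n : ℤ) : (n : U) ∈ filt V 0 := by
  simpa [Algebra.smul_def] using (filt V 0).smul_mem (n : k) one_mem_filt

theorem mem_filt_one {x : U} (hx : x ∈ V) : x ∈ filt V 1 := by
  rw [filt, pow_one]; exact Submodule.mem_sup_right hx

variable (V)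

/-- The `n`-th homogeneous component `U_n / U_{n-1}` of the associated graded algebra. -/
def grPiece (n : ℕ) : Type v := ↥(filt V n) ⧸ (filtPred V n).submoduleOf (filt V n)

instance grPieceAddCommGroup (n : ℕ) : AddCommGroup (grPiece V n) :=
  inferInstanceAs (AddCommGroup (↥(filt V n) ⧸ (filtPred V n).submoduleOf (filt V n)))

instance grPieceModule (n : ℕ) : Module k (grPiece V n) :=
  inferInstanceAs (Module k (↥(filt V n) ⧸ (filtPred V n).submoduleOf (filt V n)))

variable {V}

/-- The class in `U_n / U_{n-1}` of an element of `U_n`. -/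
def grMk (n : ℕ) : ↥(filt V n) →ₗ[k] grPiece V n :=
  ((filtPred V n).submoduleOf (filt V n)).mkQ

theorem grMk_surjective (n : ℕ) : Function.Surjective (grMk (V := V) n) :=
  Submodule.mkQ_surjective _

theorem grMk_eq_zero {n : ℕ} {x : ↥(filt V n)} (hx : (x : U) ∈ filtPred V n) :
    grMk n x = 0 :=
  (Submodule.Quotient.mk_eq_zero ((filtPred V n).submoduleOf (filt V n))).2 hx

/-- Multiplication `U_i × U_j → U_{i+j}`. -/
def filtMul (i j : ℕ) : ↥(filt V i) →ₗ[k] ↥(filt V j) →ₗ[k] ↥(filt V (i + j)) :=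
  LinearMap.mk₂ k (fun x y => ⟨x * y, filt_mul_mem x.2 y.2⟩)
    (fun _ _ _ => Subtype.ext (add_mul _ _ _))
    (fun _ _ _ => Subtype.ext (smul_mul_assoc _ _ _))
    (fun _ _ _ => Subtype.ext (mul_add _ _ _))
    (fun _ _ _ => Subtype.ext (mul_smul_comm _ _ _))

/-- The multiplication `U_i / U_{i-1} × U_j / U_{j-1} → U_{i+j} / U_{i+j-1}`. -/
def grMul (i j : ℕ) : grPiece V i →ₗ[k] grPiece V j →ₗ[k] grPiece V (i + j) :=
  Submodule.liftQ _
    (LinearMap.flip (Submodule.liftQ _ (LinearMap.flip ((filtMul i j).compr₂ (grMk (i + j))))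
      (fun y hy => LinearMap.ext fun x => grMk_eq_zero (filt_mul_pred x.2 hy))))
    (fun x hx => by
      apply LinearMap.ext; intro y
      obtain ⟨y, rfl⟩ := grMk_surjective j y
      exact grMk_eq_zero (filtPred_mul hx y.2))

theorem grMul_mk (i j : ℕ) (x : ↥(filt V i)) (y : ↥(filt V j)) :
    grMul i j (grMk i x) (grMk j y) = grMk (i + j) ⟨(x : U) * (y : U), filt_mul_mem x.2 y.2⟩ := rfl

instance grGMul : GradedMonoid.GMul (grPiece V) := ⟨fun {i j} x y => grMul i j x y⟩

instance grGOne : GradedMonoid.GOne (grPiece V) := ⟨grMk 0 ⟨1, one_mem_filt⟩⟩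

theorem gradedMonoid_mk_eq {i j : ℕ} (hij : i = j) (x : ↥(filt V i)) (y : ↥(filt V j))
    (hxy : (x : U) = y) :
    (GradedMonoid.mk i (grMk i x) : GradedMonoid (grPiece V)) = GradedMonoid.mk j (grMk j y) := by
  subst hij
  rw [Subtype.ext hxy]

theorem grMk_natCast_succ (n : ℕ) :
    grMk (V := V) 0 ⟨((n + 1 : ℕ) : U), natCast_mem_filt (n + 1)⟩ =
      grMk 0 ⟨(n : U), natCast_mem_filt n⟩ + grMk 0 ⟨1, one_mem_filt⟩ := by
  rw [← map_add]
  congr 1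
  ext
  simp

theorem grMk_intCast_negSucc (n : ℕ) :
    grMk (V := V) 0 ⟨((Int.negSucc n : ℤ) : U), intCast_mem_filt _⟩ =
      -grMk 0 ⟨((n + 1 : ℕ) : U), natCast_mem_filt (n + 1)⟩ := by
  rw [← map_neg]
  congr 1
  ext
  simp

theorem grMk_intCast_natCast (n : ℕ) :
    grMk (V := V) 0 ⟨(((n : ℕ) : ℤ) : U), intCast_mem_filt _⟩ =
      grMk 0 ⟨(n : U), natCast_mem_filt n⟩ := by
  congr 1
  ext
  simp

instance grGRing : DirectSum.GRing (grPiece V) where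
  mul_zero := fun {i j} a => map_zero (grMul i j a)
  zero_mul := fun {i j} b => LinearMap.map_zero₂ (grMul i j) b
  mul_add := fun {i j} a b c => map_add (grMul i j a) b c
  add_mul := fun {i j} a b c => LinearMap.map_add₂ (grMul i j) a b c
  one_mul := by
    rintro ⟨i, a⟩
    obtain ⟨a, rfl⟩ := grMk_surjective i a
    exact gradedMonoid_mk_eq (zero_add i) _ _ (one_mul _)
  mul_one := by
    rintro ⟨i, a⟩
    obtain ⟨a, rfl⟩ := grMk_surjective i a
    exact gradedMonoid_mk_eq (add_zero i) _ _ (mul_one _)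
  mul_assoc := by
    rintro ⟨i, a⟩ ⟨j, b⟩ ⟨l, c⟩
    obtain ⟨a, rfl⟩ := grMk_surjective i a
    obtain ⟨b, rfl⟩ := grMk_surjective j b
    obtain ⟨c, rfl⟩ := grMk_surjective l c
    exact gradedMonoid_mk_eq (add_assoc i j l) _ _ (mul_assoc _ _ _)
  natCast n := grMk 0 ⟨n, natCast_mem_filt n⟩
  natCast_zero := grMk_eq_zero (by simp)
  natCast_succ := grMk_natCast_succ
  intCast n := grMk 0 ⟨n, intCast_mem_filt n⟩
  intCast_ofNat := grMk_intCast_natCast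
  intCast_negSucc_ofNat := grMk_intCast_negSucc

theorem algebraMap_mem_filt (r : k) : algebraMap k U r ∈ filt V 0 := by
  simpa [Algebra.smul_def] using (filt V 0).smul_mem r one_mem_filt

/-- The structure map `k → U_0`. -/
def filtScalar : k →ₗ[k] ↥(filt V 0) :=
  LinearMap.codRestrict _ (Algebra.linearMap k U) algebraMap_mem_filt

instance grGAlgebra : DirectSum.GAlgebra k (grPiece V) where
  toFun := ((grMk 0).comp filtScalar).toAddMonoidHom
  map_one := congrArg (grMk 0) (Subtype.ext (map_one (algebraMap k U)))
  map_mul r s := gradedMonoid_mk_eq (add_zero 0).symm (filtScalar (r * s))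
    ⟨(filtScalar (V := V) r : U) * (filtScalar (V := V) s : U),
      filt_mul_mem (filtScalar r).2 (filtScalar s).2⟩ (map_mul (algebraMap k U) r s)
  commutes := by
    rintro r ⟨i, a⟩
    obtain ⟨a, rfl⟩ := grMk_surjective i a
    exact gradedMonoid_mk_eq ((zero_add i).trans (add_zero i).symm)
      ⟨(filtScalar (V := V) r : U) * (a : U), filt_mul_mem (filtScalar r).2 a.2⟩
      ⟨(a : U) * (filtScalar (V := V) r : U), filt_mul_mem a.2 (filtScalar r).2⟩
      (Algebra.commutes r (a : U))
  smul_def := by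
    rintro r ⟨i, a⟩
    obtain ⟨a, rfl⟩ := grMk_surjective i a
    refine Eq.trans ?_ (gradedMonoid_mk_eq (zero_add i).symm (r • a)
      ⟨(filtScalar (V := V) r : U) * (a : U), filt_mul_mem (filtScalar r).2 a.2⟩
      (Algebra.smul_def r (a : U)))
    exact congrArg (GradedMonoid.mk i) (map_smul (grMk i) r a).symm

variable (V)

/-- The associated graded algebra `⨁ₙ U_n / U_{n-1}`. -/
abbrev Gr : Type v := ⨁ n, grPiece V n

variable {V}

/-- The class in `U_1 / U_0` of an element of `V`, as an element of the associated graded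
algebra. -/
def grOfGen : ↥V →ₗ[k] Gr V :=
  (DirectSum.lof k ℕ (grPiece V) 1).comp ((grMk 1).comp
    (Submodule.inclusion (fun _ hx => mem_filt_one hx)))

end GeneratedFiltration

/-! ## Enveloping and symmetric algebras, and the PBW property -/

namespace OperadicLieSuperalgebra

open GeneratedFiltration

variable {k : Type u} {L : Type v} [Field k] [AddCommGroup L] [Module k L]
  (B : OperadicLieSuperalgebra k L)

/-- The relations `x ⊗ y - (-1)^{|x||y|} y ⊗ x - [x, y]` on the tensor algebra. -/
inductive EnvelopingRel : TensorAlgebra k L → TensorAlgebra k L → Prop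
  | intro (a b : ZMod 2) (x y : L) (hx : x ∈ B.grading a) (hy : y ∈ B.grading b) :
      EnvelopingRel (TensorAlgebra.ι k x * TensorAlgebra.ι k y)
        (koszulSign k a b • (TensorAlgebra.ι k y * TensorAlgebra.ι k x)
          + TensorAlgebra.ι k (B.bracket x y))

/-- The relations `x ⊗ y - (-1)^{|x||y|} y ⊗ x` on the tensor algebra. -/
inductive SymmetricRel : TensorAlgebra k L → TensorAlgebra k L → Prop
  | intro (a b : ZMod 2) (x y : L) (hx : x ∈ B.grading a) (hy : y ∈ B.grading b) :
      SymmetricRel (TensorAlgebra.ι k x * TensorAlgebra.ι k y)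
        (koszulSign k a b • (TensorAlgebra.ι k y * TensorAlgebra.ι k x))

/-- The universal enveloping algebra `U(L)`. -/
abbrev Enveloping : Type (max u v) := RingQuot B.EnvelopingRel

/-- The symmetric algebra `S(L)` of the super vector space `L`. -/
abbrev Symmetric : Type (max u v) := RingQuot B.SymmetricRel

/-- The natural map `L → U(L)`. -/
def envι : L →ₗ[k] B.Enveloping :=
  (RingQuot.mkAlgHom k B.EnvelopingRel).toLinearMap.comp (TensorAlgebra.ι k)

/-- The natural map `L → S(L)`. -/
def symι : L →ₗ[k] B.Symmetric :=
  (RingQuot.mkAlgHom k B.SymmetricRel).toLinearMap.comp (TensorAlgebra.ι k)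

/-- The associated graded algebra of `U(L)`, where `U_n` is spanned by the products of at most `n`
elements of the image of `L`. -/
abbrev GrEnveloping : Type (max u v) := Gr (LinearMap.range B.envι)

/-- The map `L → U_1 / U_0 ⊆ gr U(L)`. -/
def grι : L →ₗ[k] B.GrEnveloping :=
  grOfGen.comp B.envι.rangeRestrict

theorem envι_mul (a b : ZMod 2) (x y : L) (hx : x ∈ B.grading a) (hy : y ∈ B.grading b) :
    B.envι x * B.envι y = koszulSign k a b • (B.envι y * B.envι x) + B.envι (B.bracket x y) := by
  have := RingQuot.mkAlgHom_rel k (EnvelopingRel.intro (B := B) a b x y hx hy)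
  simpa [envι] using this

theorem grι_mul (x y : L) : B.grι x * B.grι y = DirectSum.lof k ℕ (grPiece _) (1 + 1)
    (grMk (1 + 1) ⟨B.envι x * B.envι y, filt_mul_mem (mem_filt_one (B.envι.mem_range_self x))
      (mem_filt_one (B.envι.mem_range_self y))⟩) :=
  DirectSum.of_mul_of _ _

theorem grι_comm (a b : ZMod 2) (x y : L) (hx : x ∈ B.grading a) (hy : y ∈ B.grading b) :
    B.grι x * B.grι y = koszulSign k a b • (B.grι y * B.grι x) := by
  rw [grι_mul, grι_mul, ← map_smul, ← map_smul, ← sub_eq_zero, ← map_sub, ← map_sub]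
  refine (congrArg _ (grMk_eq_zero ?_)).trans (map_zero _)
  have h : B.envι x * B.envι y - koszulSign k a b • (B.envι y * B.envι x)
      = B.envι (B.bracket x y) := by rw [B.envι_mul a b x y hx hy]; abel
  change B.envι x * B.envι y - koszulSign k a b • (B.envι y * B.envι x) ∈ filt _ 1
  rw [h]
  exact mem_filt_one ⟨_, rfl⟩

/-- The natural algebra map `η : S(L) → gr U(L)`, extending `L → U_1 / U_0`. -/
def eta : B.Symmetric →ₐ[k] B.GrEnveloping :=
  RingQuot.liftAlgHom k ⟨TensorAlgebra.lift k B.grι, by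
    rintro _ _ ⟨a, b, x, y, hx, hy⟩
    simpa using B.grι_comm a b x y hx hy⟩

theorem eta_symι (x : L) : B.eta (B.symι x) = B.grι x := by
  simp [eta, symι]

/-- `L` is PBW: the natural map `η : S(L) → gr U(L)` is an isomorphism. -/
def IsPBW : Prop := Function.Bijective B.eta

end OperadicLieSuperalgebra

/-! ## Contragredient Lie superalgebras -/

/-- A realization of a square matrix `A`: a vector space `𝔥` of dimension `2θ - rank A` with
linearly independent families `h_i` in `𝔥` (`coroot`) and `ξ_i` in its dual (`root`), such that
`ξ_j(h_i) = a_ij`. -/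
structure Realization {k : Type u} [Field k] {θ : ℕ} (A : Matrix (Fin θ) (Fin θ) k)
    (𝔥 : Type w) [AddCommGroup 𝔥] [Module k 𝔥] where
  finite : Module.Finite k 𝔥
  finrank_add_rank : Module.finrank k 𝔥 + A.rank = 2 * θ
  coroot : Fin θ → 𝔥
  root : Fin θ → Module.Dual k 𝔥
  linearIndependent_coroot : LinearIndependent k coroot
  linearIndependent_root : LinearIndependent k root
  root_coroot : ∀ i j, root j (coroot i) = A i j

namespace Contragredient

/-- The generators `e_i`, `f_i` and `h ∈ 𝔥`. -/
inductive Gen (θ : ℕ) (𝔥 : Type w) : Type w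
  | e (i : Fin θ) : Gen θ 𝔥
  | f (i : Fin θ) : Gen θ 𝔥
  | h (x : 𝔥) : Gen θ 𝔥

/-- The total weight of a nonassociative monomial, given the weights of the letters. -/
def weight {X : Type w} {G : Type v} [Add G] (φ : X → G) : FreeMagma X → G
  | .of x => φ x
  | .mul m n => weight φ m + weight φ n

/-- Parities of the generators: `|e_i| = |f_i| = |i|` and `|h| = 0`. -/
def genParity {θ : ℕ} {𝔥 : Type w} (p : Fin θ → ZMod 2) : Gen θ 𝔥 → ZMod 2
  | .e i => p i
  | .f i => p i
  | .h _ => 0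

/-- Degrees of the generators: `deg e_i = 1`, `deg f_i = -1` and `deg h = 0`. -/
def genDegree {θ : ℕ} {𝔥 : Type w} : Gen θ 𝔥 → ℤ
  | .e _ => 1
  | .f _ => -1
  | .h _ => 0

section Free

variable (k : Type u) [Field k] {X : Type w} {G : Type v}

/-- The homogeneous component of weight `a` in the free nonassociative algebra: the span of the
monomials of weight `a`. -/
def freeComponent [Add G] (φ : X → G) (a : G) :
    Submodule k (FreeNonUnitalNonAssocAlgebra k X) :=
  Submodule.span k ((fun m => MonoidAlgebra.single m (1 : k)) '' {m | weight φ m = a})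

theorem freeComponent_mul_mem [Add G] (φ : X → G) (a b : G)
    (x y : FreeNonUnitalNonAssocAlgebra k X) (hx : x ∈ freeComponent k φ a)
    (hy : y ∈ freeComponent k φ b) : x * y ∈ freeComponent k φ (a + b) := by
  induction hx using Submodule.span_induction with
  | zero => rw [zero_mul]; exact zero_mem _
  | add x x' _ _ h h' => rw [add_mul]; exact add_mem h h'
  | smul c x _ h => rw [smul_mul_assoc]; exact Submodule.smul_mem _ _ h
  | mem x hx =>
    obtain ⟨m, hm, rfl⟩ := hx
    induction hy using Submodule.span_induction with
    | zero => rw [mul_zero]; exact zero_mem _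
    | add y y' _ _ h h' => rw [mul_add]; exact add_mem h h'
    | smul c y _ h => rw [mul_smul_comm]; exact Submodule.smul_mem _ _ h
    | mem y hy =>
      obtain ⟨n, hn, rfl⟩ := hy
      refine Submodule.subset_span ⟨m * n, ?_, by simp [MonoidAlgebra.single_mul_single]⟩
      change weight φ m + weight φ n = a + b
      rw [show weight φ m = a from hm, show weight φ n = b from hn]

theorem freeComponent_coeff [Add G] (φ : X → G) (a : G) (x : FreeNonUnitalNonAssocAlgebra k X)
    (hx : x ∈ freeComponent k φ a) (m : FreeMagma X) (hm : weight φ m ≠ a) : x.coeff m = 0 := by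
  induction hx using Submodule.span_induction with
  | zero => simp
  | add x x' _ _ h h' => simp [h, h']
  | smul c x _ h => simp [h]
  | mem x hx =>
    obtain ⟨n, hn, rfl⟩ := hx
    have : n ≠ m := by rintro rfl; exact hm hn
    simp [this]

/-- The free nonassociative superalgebra on letters with given parities. -/
def freeSuper (φ : X → ZMod 2) : BracketSuperalgebra k (FreeNonUnitalNonAssocAlgebra k X) where
  grading := freeComponent k φ
  isCompl_grading := by
    constructor
    · rw [Submodule.disjoint_def]
      intro x h0 h1
      ext m
      by_cases h : weight φ m = 0
      · exact freeComponent_coeff k φ 1 x h1 m (by rw [h]; decide)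
      · exact freeComponent_coeff k φ 0 x h0 m h
    · rw [codisjoint_iff, eq_top_iff]
      intro x _
      induction x using MonoidAlgebra.induction_linear with
      | zero => exact zero_mem _
      | add x y hx hy => exact add_mem (hx trivial) (hy trivial)
      | single m c =>
        have hs : MonoidAlgebra.single m c = c • MonoidAlgebra.single m (1 : k) := by simp
        rw [hs]
        refine Submodule.smul_mem _ _ ?_
        have h01 : ∀ z : ZMod 2, z = 0 ∨ z = 1 := by decide
        rcases h01 (weight φ m) with h | h
        · exact Submodule.mem_sup_left (Submodule.subset_span ⟨m, h, rfl⟩)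
        · exact Submodule.mem_sup_right (Submodule.subset_span ⟨m, h, rfl⟩)
  bracket := LinearMap.mul k _
  bracket_mem := freeComponent_mul_mem k φ

theorem of_mem_freeComponent [Add G] (φ : X → G) (x : X) :
    FreeNonUnitalNonAssocAlgebra.of k x ∈ freeComponent k φ (φ x) :=
  Submodule.subset_span ⟨FreeMagma.of x, rfl, rfl⟩

end Free

section Tilde

variable {k : Type u} [Field k] {θ : ℕ} {A : Matrix (Fin θ) (Fin θ) k}
  {𝔥 : Type w} [AddCommGroup 𝔥] [Module k 𝔥]

/-- The free nonassociative algebra on the generators. -/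
abbrev FreeAlg (k : Type u) [Field k] (θ : ℕ) (𝔥 : Type w) : Type (max u w) :=
  FreeNonUnitalNonAssocAlgebra k (Gen θ 𝔥)

/-- The generator `e_i`. -/
abbrev genE (k : Type u) [Field k] {θ : ℕ} (𝔥 : Type w) (i : Fin θ) : FreeAlg k θ 𝔥 :=
  FreeNonUnitalNonAssocAlgebra.of k (Gen.e i)

/-- The generator `f_i`. -/
abbrev genF (k : Type u) [Field k] {θ : ℕ} (𝔥 : Type w) (i : Fin θ) : FreeAlg k θ 𝔥 :=
  FreeNonUnitalNonAssocAlgebra.of k (Gen.f i)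

/-- The generator given by `x ∈ 𝔥`. -/
abbrev genH (k : Type u) [Field k] (θ : ℕ) {𝔥 : Type w} (x : 𝔥) : FreeAlg k θ 𝔥 :=
  FreeNonUnitalNonAssocAlgebra.of k (Gen.h x)

/-- The relators of `𝔤̃(A, p)`: super antisymmetry and super Jacobi, the linear relations of `𝔥`,
and the relations `[h, h'] = 0`, `[h, e_i] = ξ_i(h) e_i`, `[h, f_i] = -ξ_i(h) f_i` and
`[e_i, f_j] = δ_ij h_i`. -/
inductive Relator (R : Realization A 𝔥) (p : Fin θ → ZMod 2) : FreeAlg k θ 𝔥 → Prop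
  | skew (a b : ZMod 2) (x y : FreeAlg k θ 𝔥) (hx : x ∈ freeComponent k (genParity p) a)
      (hy : y ∈ freeComponent k (genParity p) b) :
      Relator R p (x * y + koszulSign k a b • (y * x))
  | jacobi (a b c : ZMod 2) (x y z : FreeAlg k θ 𝔥) (hx : x ∈ freeComponent k (genParity p) a)
      (hy : y ∈ freeComponent k (genParity p) b) (hz : z ∈ freeComponent k (genParity p) c) :
      Relator R p ((x * y) * z + koszulSign k a (b + c) • ((y * z) * x)
        + koszulSign k c (a + b) • ((z * x) * y))
  | h_add (x y : 𝔥) : Relator R p (genH k θ (x + y) - genH k θ x - genH k θ y)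
  | h_smul (c : k) (x : 𝔥) : Relator R p (genH k θ (c • x) - c • genH k θ x)
  | h_h (x y : 𝔥) : Relator R p (genH k θ x * genH k θ y)
  | h_e (x : 𝔥) (i : Fin θ) :
      Relator R p (genH k θ x * genE k 𝔥 i - R.root i x • genE k 𝔥 i)
  | h_f (x : 𝔥) (i : Fin θ) :
      Relator R p (genH k θ x * genF k 𝔥 i + R.root i x • genF k 𝔥 i)
  | e_f_same (i : Fin θ) : Relator R p (genE k 𝔥 i * genF k 𝔥 i - genH k θ (R.coroot i))
  | e_f_ne (i j : Fin θ) (hij : i ≠ j) : Relator R p (genE k 𝔥 i * genF k 𝔥 j)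

/-- The two-sided ideal generated by the relators. -/
def relIdeal (R : Realization A 𝔥) (p : Fin θ → ZMod 2) : Submodule k (FreeAlg k θ 𝔥) :=
  sInf {I | (∀ x, Relator R p x → x ∈ I) ∧ ∀ x y, y ∈ I → x * y ∈ I ∧ y * x ∈ I}

variable (R : Realization A 𝔥) (p : Fin θ → ZMod 2)

theorem relator_mem {x : FreeAlg k θ 𝔥} (hx : Relator R p x) : x ∈ relIdeal R p :=
  Submodule.mem_sInf.2 fun _ hI => hI.1 x hx

theorem relIdeal_mul {y : FreeAlg k θ 𝔥} (hy : y ∈ relIdeal R p) (x : FreeAlg k θ 𝔥) :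
    x * y ∈ relIdeal R p ∧ y * x ∈ relIdeal R p :=
  ⟨Submodule.mem_sInf.2 fun I hI => (hI.2 x y (Submodule.mem_sInf.1 hy I hI)).1,
    Submodule.mem_sInf.2 fun I hI => (hI.2 x y (Submodule.mem_sInf.1 hy I hI)).2⟩

theorem relator_homogeneous {x : FreeAlg k θ 𝔥} (hx : Relator R p x) :
    ∃ a, x ∈ freeComponent k (genParity p) a := by
  have mulm := freeComponent_mul_mem k (genParity (𝔥 := 𝔥) p)
  have hE : ∀ i, genE k 𝔥 i ∈ freeComponent k (genParity p) (p i) :=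
    fun i => of_mem_freeComponent k (genParity p) (Gen.e i)
  have hF : ∀ i, genF k 𝔥 i ∈ freeComponent k (genParity p) (p i) :=
    fun i => of_mem_freeComponent k (genParity p) (Gen.f i)
  have hH : ∀ x, genH k θ x ∈ freeComponent k (genParity (𝔥 := 𝔥) p) 0 :=
    fun x => of_mem_freeComponent k (genParity p) (Gen.h x)
  cases hx with
  | skew a b x y hx hy =>
    exact ⟨a + b, add_mem (mulm _ _ _ _ hx hy)
      (Submodule.smul_mem _ _ (add_comm a b ▸ mulm _ _ _ _ hy hx))⟩
  | jacobi a b c x y z hx hy hz =>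
    have h2 := mulm _ _ _ _ (mulm _ _ _ _ hy hz) hx
    have h3 := mulm _ _ _ _ (mulm _ _ _ _ hz hx) hy
    rw [show b + c + a = a + b + c by ring] at h2
    rw [show c + a + b = a + b + c by ring] at h3
    exact ⟨a + b + c, add_mem (add_mem (mulm _ _ _ _ (mulm _ _ _ _ hx hy) hz)
      (Submodule.smul_mem _ _ h2)) (Submodule.smul_mem _ _ h3)⟩
  | h_add x y => exact ⟨0, sub_mem (sub_mem (hH _) (hH _)) (hH _)⟩
  | h_smul c x => exact ⟨0, sub_mem (hH _) (Submodule.smul_mem _ _ (hH _))⟩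
  | h_h x y => exact ⟨_, mulm _ _ _ _ (hH x) (hH y)⟩
  | h_e x i =>
    have h := mulm _ _ _ _ (hH x) (hE i)
    rw [zero_add] at h
    exact ⟨p i, sub_mem h (Submodule.smul_mem _ _ (hE i))⟩
  | h_f x i =>
    have h := mulm _ _ _ _ (hH x) (hF i)
    rw [zero_add] at h
    exact ⟨p i, add_mem h (Submodule.smul_mem _ _ (hF i))⟩
  | e_f_same i =>
    have h := mulm _ _ _ _ (hE i) (hF i)
    rw [CharTwo.add_self_eq_zero] at h
    exact ⟨0, sub_mem h (hH _)⟩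
  | e_f_ne i j hij => exact ⟨_, mulm _ _ _ _ (hE i) (hF j)⟩

theorem isSuperIdeal_relIdeal : (freeSuper k (genParity p)).IsSuperIdeal (relIdeal R p) where
  bracket_right x _ hy := (relIdeal_mul R p hy x).1
  bracket_left x _ hy := (relIdeal_mul R p hy x).2
  homogeneous := by
    have h01 : ∀ a : ZMod 2, a = 0 ∨ a = 1 := by decide
    have key : ∀ (a : ZMod 2) (x : FreeAlg k θ 𝔥), x ∈ relIdeal R p →
        x ∈ freeComponent k (genParity p) a →
        x ∈ (relIdeal R p ⊓ freeComponent k (genParity p) 0) ⊔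
          (relIdeal R p ⊓ freeComponent k (genParity p) 1) := by
      intro a x hx ha
      rcases h01 a with rfl | rfl
      · exact Submodule.mem_sup_left ⟨hx, ha⟩
      · exact Submodule.mem_sup_right ⟨hx, ha⟩
    have split : ∀ (x : FreeAlg k θ 𝔥) , ∃ x0 ∈ freeComponent k (genParity p) 0,
        ∃ x1 ∈ freeComponent k (genParity p) 1, x0 + x1 = x := fun x =>
      Submodule.mem_sup.1 (((freeSuper k (genParity (𝔥 := 𝔥) p)).isCompl_grading.sup_eq_top).symm ▸
        Submodule.mem_top)
    refine sInf_le ⟨fun x hx => ?_, fun x y hy => ?_⟩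
    · obtain ⟨a, ha⟩ := relator_homogeneous R p hx
      exact key a x (relator_mem R p hx) ha
    · obtain ⟨x0, hx0, x1, hx1, rfl⟩ := split x
      obtain ⟨y0, hy0, y1, hy1, rfl⟩ := Submodule.mem_sup.1 hy
      have mulm := freeComponent_mul_mem k (genParity (𝔥 := 𝔥) p)
      have l0 : ∀ z, _ := fun z => relIdeal_mul R p hy0.1 z
      have l1 : ∀ z, _ := fun z => relIdeal_mul R p hy1.1 z
      have e1 : (x0 + x1) * (y0 + y1) = x0 * y0 + x0 * y1 + (x1 * y0 + x1 * y1) := by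
        rw [add_mul, mul_add, mul_add]
      have e2 : (y0 + y1) * (x0 + x1) = y0 * x0 + y0 * x1 + (y1 * x0 + y1 * x1) := by
        rw [add_mul, mul_add, mul_add]
      rw [e1, e2]
      exact ⟨add_mem
          (add_mem (key _ _ (l0 x0).1 (mulm _ _ _ _ hx0 hy0.2))
            (key _ _ (l1 x0).1 (mulm _ _ _ _ hx0 hy1.2)))
          (add_mem (key _ _ (l0 x1).1 (mulm _ _ _ _ hx1 hy0.2))
            (key _ _ (l1 x1).1 (mulm _ _ _ _ hx1 hy1.2))),
        add_mem
          (add_mem (key _ _ (l0 x0).2 (mulm _ _ _ _ hy0.2 hx0))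
            (key _ _ (l0 x1).2 (mulm _ _ _ _ hy0.2 hx1)))
          (add_mem (key _ _ (l1 x0).2 (mulm _ _ _ _ hy1.2 hx0))
            (key _ _ (l1 x1).2 (mulm _ _ _ _ hy1.2 hx1)))⟩

/-- The underlying space of `𝔤̃(A, p)`. -/
abbrev Tilde : Type (max u w) := FreeAlg k θ 𝔥 ⧸ relIdeal R p

/-- The operadic Lie superalgebra `𝔤̃(A, p)` presented by the generators `e_i`, `f_i`, `𝔥` and the
relations above. -/
def tilde : OperadicLieSuperalgebra k (Tilde R p) :=
  OperadicLieSuperalgebra.ofQuotient (freeSuper k (genParity p)) (relIdeal R p)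
    (isSuperIdeal_relIdeal R p)
    (fun a b x y hx hy => relator_mem R p (Relator.skew a b x y hx hy))
    (fun a b c x y z hx hy hz => relator_mem R p (Relator.jacobi a b c x y z hx hy hz))

/-- The component of degree `n` of the `ℤ`-grading of `𝔤̃(A, p)` with `deg e_i = 1`,
`deg f_i = -1`, `deg h = 0`. -/
def tildeDegree (n : ℤ) : Submodule k (Tilde R p) :=
  (freeComponent k genDegree n).map (relIdeal R p).mkQ

/-- The image of `𝔥` in `𝔤̃(A, p)`. -/
def tildeCartan : Submodule k (Tilde R p) :=
  Submodule.span k (Set.range fun x : 𝔥 => (relIdeal R p).mkQ (genH k θ x))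

/-- The `ℤ`-homogeneous ideals of `𝔤̃(A, p)` that intersect `𝔥` trivially. -/
def trivialIdeals : Set (Submodule k (Tilde R p)) :=
  {J | (tilde R p).toBracketSuperalgebra.IsSuperIdeal J ∧ (J ≤ ⨆ n, J ⊓ tildeDegree R p n) ∧
    J ⊓ tildeCartan R p = ⊥}

/-- The ideal `𝔯`: the largest `ℤ`-homogeneous ideal that intersects `𝔥` trivially, that is, the
sum of all of them. -/
def radical : Submodule k (Tilde R p) := sSup (trivialIdeals R p)

theorem isSuperIdeal_radical :
    (tilde R p).toBracketSuperalgebra.IsSuperIdeal (radical R p) :=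
  BracketSuperalgebra.isSuperIdeal_sSup _ _ fun _ hJ => hJ.1

end Tilde

end Contragredient

/-- The contragredient Lie superalgebra `𝔤(A, p) = 𝔤̃(A, p) / 𝔯` of a matrix `A` with a realization
and a parity vector `p` (with values in `ℤ/2`). -/
def contragredientLieSuperalgebra {k : Type u} [Field k] {θ : ℕ} {A : Matrix (Fin θ) (Fin θ) k}
    {𝔥 : Type w} [AddCommGroup 𝔥] [Module k 𝔥] (R : Realization A 𝔥) (p : Fin θ → ZMod 2) :
    OperadicLieSuperalgebra k (Contragredient.Tilde R p ⧸ Contragredient.radical R p) :=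
  (Contragredient.tilde R p).quotient (Contragredient.radical R p)
    (Contragredient.isSuperIdeal_radical R p)

end

/-! The proof combines a PBW criterion valid over every field with the verification that `𝔤(A, p)`
satisfies it.

The criterion, `IsStrict.isPBW`, asks for the identities that small characteristic fails to supply:
`[x, x] = 0` when the sign `(-1)^{|x||x|}` equals `1` in the field (so also for odd `x` in
characteristic 2), and `[[x, x], x] = 0` for the other homogeneous `x`. It is a diamond lemma
argument. In words over an ordered homogeneous basis, a descent `x y` is replaced by `± y x + [x,
y]`, and a square `x x` whose sign is not `1` by `½ [x, x]`. Length and number of inversions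
decrease lexicographically, so normal forms exist. Overlaps are resolved by the Jacobi identity,
except `x x x`, which needs `[[x, x], x] = 0` (`contextNormalForm_overlap`). Hence the normal form
descends to `U`, never lengthens words and fixes standard words. Standard words span `S`, and a
combination of standard words of length `n` that falls into `U_{n-1}` vanishes; this gives
injectivity of `η`. Surjectivity holds because `gr U` is generated in degree one.

For `𝔤(A, p)`, the operadic identities alone make the two defects `[x, x]` and `[[x, x], x]` central
in `𝔤̃` and additive in `x` of fixed parity, so it suffices to treat monomials in the generators. If
a monomial has nonzero `ℤ`-degree, its defect spans a homogeneous ideal in nonzero degree, which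
therefore misses `𝔥` and lies in `𝔯` (`mem_radical_of_central`). If it has degree zero, it lies in
`𝔥` by the triangular decomposition (`tildeWord_mem_tildeCartan`), and `𝔥` is abelian. -/

noncomputable section

/-! ## The Koszul sign -/

section KoszulSign

variable {k : Type u} [Field k]

theorem koszulSign_comm (a b : ZMod 2) : koszulSign k a b = koszulSign k b a := by
  simp [koszulSign, and_comm]

theorem koszulSign_add_right (a b c : ZMod 2) :
    koszulSign k a (b + c) = koszulSign k a b * koszulSign k a c := by
  have h : ∀ z : ZMod 2, z = 0 ∨ z = 1 := by decide
  have h2 : (1 + 1 : ZMod 2) = 0 := rfl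
  rcases h a with rfl | rfl <;> rcases h b with rfl | rfl <;> rcases h c with rfl | rfl <;>
    simp [koszulSign, h2]

theorem koszulSign_add_left (a b c : ZMod 2) :
    koszulSign k (a + b) c = koszulSign k a c * koszulSign k b c := by
  rw [koszulSign_comm, koszulSign_add_right, koszulSign_comm c a, koszulSign_comm c b]

variable (k) in
theorem koszulSign_eq_one_or (a b : ZMod 2) : koszulSign k a b = 1 ∨ koszulSign k a b = -1 := by
  unfold koszulSign; split_ifs <;> simp

end KoszulSign

/-! ## Words, inversions and reducible pairs -/

namespace List

variable {X : Type w} [LinearOrder X]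

/-- The number of inversions of a word. -/
def inversions : List X → ℕ
  | [] => 0
  | x :: w => w.countP (· < x) + inversions w

/-- Only the swapped pair changes its contribution: every other letter sees the same multiset to its
right. -/
theorem inversions_swap (a b : List X) {x y : X} (h : y < x) :
    (a ++ y :: x :: b).inversions < (a ++ x :: y :: b).inversions := by
  induction a with
  | nil => simp [inversions, h, h.not_gt]; omega
  | cons z a ih =>
    have : (a ++ y :: x :: b).countP (· < z) = (a ++ x :: y :: b).countP (· < z) :=
      ((Perm.swap x y b).append_left a).countP_eq _
    simp only [cons_append, inversions, this]
    omega

/-- Words are compared by their length first and by their number of inversions next. -/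
def wordSize (w : List X) : ℕ ×ₗ ℕ := toLex (w.length, w.inversions)

theorem wordSize_induction {P : List X → Prop}
    (h : ∀ w, (∀ v, v.wordSize < w.wordSize → P v) → P w) (w : List X) : P w :=
  (InvImage.wf List.wordSize (wellFounded_lt (α := ℕ ×ₗ ℕ))).induction w h

theorem wordSize_lt_of_length_lt {v w : List X} (h : v.length < w.length) :
    v.wordSize < w.wordSize := Prod.Lex.toLex_lt_toLex.2 (Or.inl h)

theorem wordSize_swap (a b : List X) {x y : X} (h : y < x) :
    (a ++ y :: x :: b).wordSize < (a ++ x :: y :: b).wordSize :=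
  Prod.Lex.toLex_lt_toLex.2 (Or.inr ⟨by simp, inversions_swap a b h⟩)

end List

namespace OperadicLieSuperalgebra

open TensorAlgebra Module

/-! ### Words in a basis of `L` as a basis of the tensor algebra. -/

section Words

variable {k : Type u} {L : Type v} [Field k] [AddCommGroup L] [Module k L] {X : Type w}

/-- The product in the tensor algebra of the basis vectors in a word. -/
def word (bas : Basis X k L) (w : List X) : TensorAlgebra k L :=
  (w.map fun x => ι k (bas x)).prod

variable (bas : Basis X k L)

@[simp] theorem word_nil : word bas [] = 1 := rfl

@[simp] theorem word_cons (x : X) (w : List X) : word bas (x :: w) = ι k (bas x) * word bas w := by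
  simp [word]

@[simp] theorem word_append (v w : List X) : word bas (v ++ w) = word bas v * word bas w := by
  simp [word]

/-- The basis of the tensor algebra that consists of the words. -/
def wordBasis : Basis (List X) k (TensorAlgebra k L) :=
  bas.tensorAlgebra.reindex FreeMonoid.toList

@[simp] theorem wordBasis_apply (w : List X) : wordBasis bas w = word bas w := by
  rw [wordBasis, Basis.reindex_apply, Basis.tensorAlgebra, Basis.map_apply]
  change (equivFreeAlgebra bas).symm (FreeAlgebra.basisFreeMonoid k X (FreeMonoid.ofList w)) = _
  have : FreeAlgebra.basisFreeMonoid k X (FreeMonoid.ofList w)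
      = (w.map (FreeAlgebra.ι k)).prod := by
    simp [FreeAlgebra.basisFreeMonoid, FreeAlgebra.equivMonoidAlgebraFreeMonoid,
      FreeMonoid.lift_apply]
  rw [this, map_list_prod, List.map_map, word]
  congr 1
  refine List.map_congr_left fun x _ => ?_
  simp [equivFreeAlgebra]

theorem span_word : Submodule.span k (Set.range (word bas)) = ⊤ := by
  rw [← (wordBasis bas).span_eq]
  congr 2
  exact funext fun w => (wordBasis_apply bas w).symm

theorem ι_mem_span_word (z : L) :
    ι k z ∈ Submodule.span k (word bas '' {v : List X | v.length = 1}) := by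
  have hz : z ∈ (⊤ : Submodule k L) := trivial
  rw [← bas.span_eq] at hz
  induction hz using Submodule.span_induction with
  | zero => rw [map_zero]; exact zero_mem _
  | add x y _ _ hx hy => rw [map_add]; exact add_mem hx hy
  | smul c x _ hx => rw [map_smul]; exact Submodule.smul_mem _ _ hx
  | mem x hx =>
    obtain ⟨x, rfl⟩ := hx
    exact Submodule.subset_span ⟨[x], rfl, by simp⟩

theorem repr_support {S : Set (List X)} {t : TensorAlgebra k L}
    (ht : t ∈ Submodule.span k (word bas '' S)) {v : List X}
    (hv : (wordBasis bas).repr t v ≠ 0) : v ∈ S := by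
  have h : word bas '' S = wordBasis bas '' S := by
    ext; simp
  rw [h, Basis.mem_span_image] at ht
  exact ht (Finsupp.mem_support_iff.2 hv)

end Words

/-! ### The rewriting system and its normal forms. -/

section NormalForm

variable {k : Type u} {L : Type v} [Field k] [AddCommGroup L] [Module k L]
  (B : OperadicLieSuperalgebra k L) {X : Type w} [LinearOrder X] (bas : Basis X k L)
  (par : X → ZMod 2)

variable (k) in
/-- The pairs of letters that do not occur next to each other in a standard word. -/
def IsReducible (x y : X) : Prop := y < x ∨ x = y ∧ koszulSign k (par x) (par x) ≠ 1

/-- What a reducible pair of letters is replaced by. -/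
def rewritePair (x y : X) : TensorAlgebra k L :=
  -- For a reducible pair `x x` the sign differs from `1`, so `2` is invertible and this is the
  -- solution of `2 x x = [x, x]`.
  if x = y then (2⁻¹ : k) • ι k (B.bracket (bas x) (bas x))
  else koszulSign k (par x) (par y) • (ι k (bas y) * ι k (bas x))
    + ι k (B.bracket (bas x) (bas y))

theorem rewritePair_self (x : X) :
    B.rewritePair bas par x x = (2⁻¹ : k) • ι k (B.bracket (bas x) (bas x)) := if_pos rfl

theorem rewritePair_of_ne {x y : X} (h : x ≠ y) :
    B.rewritePair bas par x y = koszulSign k (par x) (par y) • (ι k (bas y) * ι k (bas x))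
      + ι k (B.bracket (bas x) (bas y)) := if_neg h

/-- The words that are smaller than the pair `x y` in every context. -/
def IsSmaller (x y : X) (v : List X) : Prop :=
  ∀ a b : List X, (a ++ (v ++ b)).wordSize < (a ++ x :: y :: b).wordSize

theorem isSmaller_of_length {x y : X} {v : List X} (h : v.length = 1) : IsSmaller x y v :=
  fun a b => List.wordSize_lt_of_length_lt (by simp [h, add_comm])

theorem rewritePair_mem {x y : X} (h : IsReducible k par x y) :
    B.rewritePair bas par x y ∈ Submodule.span k (word bas '' {v | IsSmaller x y v}) := by
  have hι : ∀ z, ι k z ∈ Submodule.span k (word bas '' {v | IsSmaller x y v}) := fun z =>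
    Submodule.span_mono (Set.image_mono fun v hv => isSmaller_of_length hv)
      (ι_mem_span_word bas z)
  unfold rewritePair
  split_ifs with hxy
  · exact Submodule.smul_mem _ _ (hι _)
  · refine add_mem (Submodule.smul_mem _ _ (Submodule.subset_span ⟨[y, x], ?_, by simp⟩)) (hι _)
    intro a b
    exact List.wordSize_swap a b (h.resolve_right fun h => hxy h.1)

/-- A word with a marked pair of adjacent letters, with the pair replaced. -/
def rewriteAt (q : List X × X × X × List X) : TensorAlgebra k L :=
  word bas q.1 * B.rewritePair bas par q.2.1 q.2.2.1 * word bas q.2.2.2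

/-- Termination of the rewriting: a swap removes an inversion, and a bracket shortens the word. -/
theorem rewriteAt_mem {q : List X × X × X × List X} (h : IsReducible k par q.2.1 q.2.2.1) :
    B.rewriteAt bas par q ∈ Submodule.span k
      (word bas '' {v | v.wordSize < (q.1 ++ q.2.1 :: q.2.2.1 :: q.2.2.2).wordSize}) := by
  obtain ⟨a, x, y, b⟩ := q
  simp only at h ⊢
  have := B.rewritePair_mem bas par h
  simp only [rewriteAt]
  generalize B.rewritePair bas par x y = s at this ⊢
  induction this using Submodule.span_induction with
  | zero => simp
  | add s t _ _ hs ht => rw [mul_add, add_mul]; exact add_mem hs ht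
  | smul c s _ hs => rw [mul_smul_comm, smul_mul_assoc]; exact Submodule.smul_mem _ _ hs
  | mem s hs =>
    obtain ⟨v, hv, rfl⟩ := hs
    exact Submodule.subset_span ⟨a ++ (v ++ b), hv a b, by simp [mul_assoc]⟩

variable (k) in
/-- The occurrences of reducible pairs in a word. -/
def IsRedex (w : List X) (q : List X × X × X × List X) : Prop :=
  w = q.1 ++ q.2.1 :: q.2.2.1 :: q.2.2.2 ∧ IsReducible k par q.2.1 q.2.2.1

variable (k) in
/-- The standard words: those without reducible pairs. -/
def IsStandard (w : List X) : Prop := ∀ q, ¬ IsRedex k par w q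

open Classical in
/-- The normal form of a word. -/
def wordNormalForm (w : List X) : TensorAlgebra k L :=
  if h : ∃ q, IsRedex k par w q then
    ((wordBasis bas).repr (B.rewriteAt bas par h.choose)).sum fun v c =>
      -- The test serves the well-founded recursion only; by `rewriteAt_mem` it succeeds for every
      -- `v` in the support.
      c • if v.wordSize < w.wordSize then wordNormalForm v else 0
  else word bas w
termination_by (wellFounded_lt (α := ℕ ×ₗ ℕ)).wrap w.wordSize
decreasing_by assumption

/-- The normal form of an element of the tensor algebra. -/
def normalForm : TensorAlgebra k L →ₗ[k] TensorAlgebra k L :=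
  (wordBasis bas).constr k (B.wordNormalForm bas par)

theorem normalForm_word (w : List X) :
    B.normalForm bas par (word bas w) = B.wordNormalForm bas par w := by
  rw [← wordBasis_apply, normalForm, Basis.constr_basis]

theorem normalForm_standard {w : List X} (h : IsStandard k par w) :
    B.normalForm bas par (word bas w) = word bas w := by
  rw [normalForm_word, wordNormalForm, dif_neg]
  exact fun ⟨q, hq⟩ => h q hq

/-- This controls only the redex chosen in the recursion. That every other redex gives the same
result is confluence, proved in `isConfluentAt`. -/
theorem exists_redex_normalForm {w : List X} (h : ¬ IsStandard k par w) :
    ∃ q, IsRedex k par w q ∧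
      B.normalForm bas par (word bas w) = B.normalForm bas par (B.rewriteAt bas par q) := by
  have h' : ∃ q, IsRedex k par w q := by simpa [IsStandard] using h
  refine ⟨h'.choose, h'.choose_spec, ?_⟩
  rw [normalForm_word, wordNormalForm, dif_pos h', normalForm, Basis.constr_apply]
  refine Finsupp.sum_congr fun v hv => ?_
  have h1 := repr_support bas (B.rewriteAt_mem bas par h'.choose_spec.2)
    (Finsupp.mem_support_iff.1 hv)
  rw [Set.mem_ofPred_eq, ← h'.choose_spec.1] at h1
  rw [if_pos h1]

end NormalForm

end OperadicLieSuperalgebra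

/-! ### Strictness and the resolution of overlaps. -/

namespace OperadicLieSuperalgebra

open TensorAlgebra Module

variable {k : Type u} {L : Type v} [Field k] [AddCommGroup L] [Module k L]

/-- The identities that are not implied by the operadic ones in characteristic `2` and `3`:
`[x, x] = 0` if `|x| = 0` or the characteristic is `2`, and `[[x, x], x] = 0` for the other
homogeneous elements. -/
structure IsStrict (B : OperadicLieSuperalgebra k L) : Prop where
  bracket_self : ∀ (a : ZMod 2) (x : L), x ∈ B.grading a → koszulSign k a a = 1 →
    B.bracket x x = 0
  bracket_bracket_self : ∀ (a : ZMod 2) (x : L), x ∈ B.grading a → koszulSign k a a ≠ 1 →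
    B.bracket (B.bracket x x) x = 0

/-- A sign other than `1` is a `-1` different from `1`, so the characteristic is not 2. -/
theorem half_smul {M : Type w} [AddCommGroup M] [Module k M] {a b : ZMod 2}
    (h : koszulSign k a b ≠ 1) (v : M) : (2⁻¹ : k) • (v + v) = v := by
  have h2 : (2 : k) ≠ 0 := by
    intro h2
    apply h
    rw [(koszulSign_eq_one_or k a b).resolve_left h]
    linear_combination -h2
  rw [← two_smul k v, inv_smul_smul₀ h2]

theorem eq_zero_of_eq_koszulSign_smul {M : Type w} [AddCommGroup M] [Module k M] {a b : ZMod 2}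
    (h : koszulSign k a b ≠ 1) {v : M} (hv : v = koszulSign k a b • v) : v = 0 := by
  rw [(koszulSign_eq_one_or k a b).resolve_left h, neg_one_smul, eq_neg_iff_add_eq_zero] at hv
  rw [← half_smul h v, hv, smul_zero]

section Confluence

variable (B : OperadicLieSuperalgebra k L) {X : Type w} [LinearOrder X] (bas : Basis X k L)
  (par : X → ZMod 2)

/-- The normal form in a context of two words. -/
def contextNormalForm (a b : List X) : TensorAlgebra k L →ₗ[k] TensorAlgebra k L :=
  B.normalForm bas par ∘ₗ LinearMap.mulRight k (word bas b) ∘ₗ LinearMap.mulLeft k (word bas a)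

theorem contextNormalForm_apply (a b : List X) (s : TensorAlgebra k L) :
    B.contextNormalForm bas par a b s = B.normalForm bas par (word bas a * s * word bas b) := rfl

theorem contextNormalForm_append (a b : List X) (x : X) (s : TensorAlgebra k L) :
    B.contextNormalForm bas par (a ++ [x]) b s
      = B.contextNormalForm bas par a b (ι k (bas x) * s) := by
  simp [contextNormalForm_apply, mul_assoc]

theorem contextNormalForm_cons (a b : List X) (x : X) (s : TensorAlgebra k L) :
    B.contextNormalForm bas par a (x :: b) s
      = B.contextNormalForm bas par a b (s * ι k (bas x)) := by
  simp [contextNormalForm_apply, mul_assoc]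

/-- The normal form of a word agrees with that of everything it rewrites to in one step. -/
def IsConfluentAt (w : List X) : Prop :=
  ∀ q, IsRedex k par w q →
    B.normalForm bas par (word bas w) = B.normalForm bas par (B.rewriteAt bas par q)

variable {B bas par}

theorem IsConfluentAt.contextNormalForm_pair {a b : List X} {x y : X}
    (h : B.IsConfluentAt bas par (a ++ x :: y :: b)) (hxy : IsReducible k par x y) :
    B.contextNormalForm bas par a b (ι k (bas x) * ι k (bas y))
      = B.contextNormalForm bas par a b (B.rewritePair bas par x y) := by
  have := h (a, x, y, b) ⟨rfl, hxy⟩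
  simpa [contextNormalForm_apply, rewriteAt, mul_assoc] using this

variable (hB : B.IsStrict) (hpar : ∀ x, bas x ∈ B.grading (par x))
include hB hpar

/-- The relation of the enveloping algebra for two letters in either order. A descent is rewritten
directly, an ascent follows from the reversed descent by antisymmetry, and equal letters use `½ [x,
x]` or, when the sign is `1`, the strictness condition `[x, x] = 0`. -/
theorem contextNormalForm_letters {a b : List X} (x y : X)
    (h1 : B.IsConfluentAt bas par (a ++ x :: y :: b))
    (h2 : B.IsConfluentAt bas par (a ++ y :: x :: b)) :
    B.contextNormalForm bas par a b (ι k (bas x) * ι k (bas y))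
      = koszulSign k (par x) (par y) •
          B.contextNormalForm bas par a b (ι k (bas y) * ι k (bas x))
        + B.contextNormalForm bas par a b (ι k (B.bracket (bas x) (bas y))) := by
  have hs := B.skew _ _ _ _ (hpar x) (hpar y)
  have hE := congrArg (B.contextNormalForm bas par a b ∘ₗ ι k) hs
  simp only [LinearMap.comp_apply, map_add, map_smul, map_zero] at hE
  rcases lt_trichotomy y x with h | rfl | h
  · rw [h1.contextNormalForm_pair (Or.inl h), rewritePair_of_ne _ _ _ h.ne', map_add, map_smul]
  · by_cases hy : koszulSign k (par y) (par y) = 1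
    · rw [hB.bracket_self _ _ (hpar y) hy, hy]; simp
    · rw [h1.contextNormalForm_pair (Or.inr ⟨rfl, hy⟩), rewritePair_self,
        (koszulSign_eq_one_or k _ _).resolve_left hy, map_smul]
      linear_combination (norm := module)
        half_smul hy (B.contextNormalForm bas par a b (ι k (B.bracket (bas y) (bas y))))
  · rw [h2.contextNormalForm_pair (Or.inl h), rewritePair_of_ne _ _ _ h.ne', map_add, map_smul,
      koszulSign_comm (par y)]
    rcases koszulSign_eq_one_or k (par x) (par y) with h | h <;> rw [h] at hE ⊢
    · linear_combination (norm := module) -hE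
    · linear_combination (norm := module) -hE

variable (hspan : ∀ a, B.grading a ≤ Submodule.span k (bas '' {x | par x = a}))
include hspan

/-- Bilinear extension from letters to homogeneous elements. Expanding these may produce any two
letters, so confluence is required at all words of this length. -/
theorem contextNormalForm_mul_mul {a b : List X}
    (h : ∀ w : List X, w.length = a.length + b.length + 2 → B.IsConfluentAt bas par w)
    {c d : ZMod 2} {x y : L} (hx : x ∈ B.grading c) (hy : y ∈ B.grading d) :
    B.contextNormalForm bas par a b (ι k x * ι k y)
      = koszulSign k c d • B.contextNormalForm bas par a b (ι k y * ι k x)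
        + B.contextNormalForm bas par a b (ι k (B.bracket x y)) := by
  have hx' := hspan c hx
  have hy' := hspan d hy
  clear hx hy
  induction hx' using Submodule.span_induction with
  | zero => simp
  | add x x' _ _ h h' =>
    simp only [map_add, add_mul, mul_add, LinearMap.add_apply, h, h', smul_add]
    abel
  | smul r x _ h =>
    simp only [map_smul, smul_mul_assoc, mul_smul_comm, LinearMap.smul_apply, h, smul_add]
    rw [smul_comm]
  | mem x hx =>
    obtain ⟨x, rfl, rfl⟩ := hx
    induction hy' using Submodule.span_induction with
    | zero => simp
    | add x x' _ _ h h' =>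
      simp only [map_add, add_mul, mul_add, h, h', smul_add]
      abel
    | smul r x _ h =>
      simp only [map_smul, smul_mul_assoc, mul_smul_comm, h, smul_add]
      rw [smul_comm]
    | mem y hy =>
      obtain ⟨y, rfl, rfl⟩ := hy
      exact contextNormalForm_letters hB hpar x y (h _ (by simp; omega)) (h _ (by simp; omega))

/-- The diamond for `x y z`: the two rewritings are carried on to a common reordering using
relations at smaller words, and their difference is a combination of brackets that Jacobi makes
zero. The cases are `x > y > z`, `x > y = z`, `x = y > z` and `x = y = z`. -/
theorem contextNormalForm_overlap {a b : List X} {x y z : X}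
    (ih : ∀ v : List X, v.wordSize < (a ++ x :: y :: z :: b).wordSize →
      B.IsConfluentAt bas par v)
    (hxy : IsReducible k par x y) (hyz : IsReducible k par y z) :
    B.contextNormalForm bas par a b (B.rewritePair bas par x y * ι k (bas z))
      = B.contextNormalForm bas par a b (ι k (bas x) * B.rewritePair bas par y z) := by
  -- Once a bracket has replaced two of the three letters the words are shorter, so there the
  -- relation may be used for arbitrary homogeneous elements.
  have hlen : ∀ v : List X, v.length = a.length + b.length + 2 → B.IsConfluentAt bas par v :=
    fun v hv => ih v (List.wordSize_lt_of_length_lt (by simp; omega))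
  have rel := fun (c d : ZMod 2) (u v : L) (hu : u ∈ B.grading c) (hv : v ∈ B.grading d) =>
    contextNormalForm_mul_mul (a := a) (b := b) hB hpar hspan hlen hu hv
  have rl := fun (t u v : X) (h1 : (a ++ t :: u :: v :: b).wordSize < _)
      (h2 : (a ++ t :: v :: u :: b).wordSize < _) =>
    contextNormalForm_letters hB hpar (a := a ++ [t]) (b := b) u v
      (ih _ (by simpa using h1)) (ih _ (by simpa using h2))
  have rr := fun (t u v : X) (h1 : (a ++ u :: v :: t :: b).wordSize < _)
      (h2 : (a ++ v :: u :: t :: b).wordSize < _) =>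
    contextNormalForm_letters hB hpar (a := a) (b := t :: b) u v (ih _ h1) (ih _ h2)
  have pl := fun (t u v : X) (h1 : (a ++ t :: u :: v :: b).wordSize < _) =>
    (ih (a ++ [t] ++ u :: v :: b) (by simpa using h1)).contextNormalForm_pair
  have pr := fun (t u v : X) (h1 : (a ++ u :: v :: t :: b).wordSize < _) =>
    (ih (a ++ u :: v :: t :: b) h1).contextNormalForm_pair
  have swap1 := fun (u v t : X) (h : v < u) => List.wordSize_swap a (t :: b) h
  have swap2 := fun (t u v : X) (h : v < u) => by
    simpa using List.wordSize_swap (a ++ [t]) b h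
  simp only [contextNormalForm_append, contextNormalForm_cons, mul_assoc] at rl rr pl pr
  set E := B.contextNormalForm bas par a b with hE
  have hx := hpar x
  have hy := hpar y
  have hz := hpar z
  have jac := congrArg (E ∘ₗ ι k) (B.jacobi _ _ _ _ _ _ hx hy hz)
  have hzx : B.bracket (bas z) (bas x) = -(koszulSign k (par x) (par z) •
      B.bracket (bas x) (bas z)) := by
    rw [eq_neg_iff_add_eq_zero, koszulSign_comm]
    exact B.skew _ _ _ _ hz hx
  have g1 := rel _ _ _ _ (B.bracket_mem _ _ _ _ hx hy) hz
  have g2 := rel _ _ _ _ (B.bracket_mem _ _ _ _ hy hz) hx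
  have g3 := rel _ _ _ _ (B.bracket_mem _ _ _ _ hx hz) hy
  simp only [LinearMap.comp_apply, map_add, map_smul, map_zero, hzx, map_neg,
    LinearMap.neg_apply, LinearMap.smul_apply, koszulSign_add_left, koszulSign_add_right,
    koszulSign_comm (par z) (par x), koszulSign_comm (par z) (par y),
    koszulSign_comm (par y) (par x)] at jac g1 g2 g3
  rcases hxy with hxy | ⟨rfl, hsx⟩
  · rcases hyz with hyz | ⟨rfl, hsy⟩
    -- The two routes from `x y z` to `z y x`: `f1` and `f2` pass through `y x z` and `y z x`, `f3`
    -- and `f4` through `x z y` and `z x y`.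
    · have f1 := rl y x z (swap1 x y z hxy) ((swap2 y x z (hyz.trans hxy)).trans (swap1 x y z hxy))
      have f2 := rr x y z ((swap2 y x z (hyz.trans hxy)).trans (swap1 x y z hxy))
        ((swap1 y z x hyz).trans ((swap2 y x z (hyz.trans hxy)).trans (swap1 x y z hxy)))
      have f3 := rr y x z (swap2 x y z hyz) ((swap1 x z y (hyz.trans hxy)).trans (swap2 x y z hyz))
      have f4 := rl z x y ((swap1 x z y (hyz.trans hxy)).trans (swap2 x y z hyz))
        ((swap2 z x y hxy).trans ((swap1 x z y (hyz.trans hxy)).trans (swap2 x y z hyz)))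
      rw [rewritePair_of_ne _ _ _ hxy.ne', rewritePair_of_ne _ _ _ hyz.ne']
      simp only [add_mul, mul_add, smul_mul_assoc, mul_smul_comm, map_add, map_smul, mul_assoc]
      have e1 := koszulSign_eq_one_or k (par x) (par y)
      have e2 := koszulSign_eq_one_or k (par x) (par z)
      have e3 := koszulSign_eq_one_or k (par y) (par z)
      generalize koszulSign k (par x) (par y) = s1 at *
      generalize koszulSign k (par x) (par z) = s2 at *
      generalize koszulSign k (par y) (par z) = s3 at *
      linear_combination (norm := skip) s1 • f1 + (s1 * s2) • f2 - s3 • f3 - (s3 * s2) • f4 + g1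
        + (s1 * s2) • g2 - s3 • g3 + jac
      -- The coefficients match only because each sign squares to `1`, whence the case split.
      rcases e1 with rfl | rfl <;> rcases e2 with rfl | rfl <;> rcases e3 with rfl | rfl <;> module
    · have f1 := rl y x y (swap1 x y y hxy) ((swap2 y x y hxy).trans (swap1 x y y hxy))
      have f2 := pr x y y ((swap2 y x y hxy).trans (swap1 x y y hxy)) (Or.inr ⟨rfl, hsy⟩)
      have e3 := (koszulSign_eq_one_or k (par y) (par y)).resolve_left hsy
      have e1 := koszulSign_eq_one_or k (par x) (par y)
      have half := half_smul (M := TensorAlgebra k L) hsy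
      rw [rewritePair_self] at f2 ⊢
      rw [rewritePair_of_ne _ _ _ hxy.ne']
      simp only [add_mul, smul_mul_assoc, mul_smul_comm, map_add, map_smul, mul_assoc,
        e3] at f1 f2 jac g1 g2 g3 ⊢
      generalize koszulSign k (par x) (par y) = s1 at *
      -- With a repeated letter, two of the Jacobi terms are multiples of the same double bracket,
      -- so half of the identity is what is needed.
      linear_combination (norm := skip) s1 • f1 + (s1 * s1) • f2 + g1 + (2⁻¹ : k) • g2
        + (2⁻¹ : k) • jac - half (E (ι k (B.bracket (B.bracket (bas x) (bas y)) (bas y))))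
      rcases e1 with rfl | rfl <;> module
  · have half := half_smul (M := TensorAlgebra k L) hsx
    have e1 := (koszulSign_eq_one_or k (par x) (par x)).resolve_left hsx
    rcases hyz with hyz | ⟨rfl, hsy⟩
    · have f1 := rr x x z (swap2 x x z hyz) ((swap1 x z x hyz).trans (swap2 x x z hyz))
      have f2 := pl z x x ((swap1 x z x hyz).trans (swap2 x x z hyz)) (Or.inr ⟨rfl, hsx⟩)
      have e2 := koszulSign_eq_one_or k (par x) (par z)
      rw [rewritePair_self] at f2 ⊢
      rw [rewritePair_of_ne _ _ _ hyz.ne']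
      simp only [mul_add, smul_mul_assoc, mul_smul_comm, map_add, map_smul, e1] at f1 f2 jac g1 g2 g3 ⊢
      generalize koszulSign k (par x) (par z) = s1 at *
      linear_combination (norm := skip) (-s1) • f1 - (s1 * s1) • f2 + (2⁻¹ : k) • g1 - s1 • g3
        + (2⁻¹ : k) • jac + s1 • half (E (ι k (B.bracket (B.bracket (bas x) (bas z)) (bas x))))
      rcases e2 with rfl | rfl <;> module
    -- For `x x x` both sides are half of `[x, x] x` and of `x [x, x]`, which agree exactly when the
    -- commutator `[[x, x], x]` contributes nothing.
    · rw [hB.bracket_bracket_self _ _ hx hsx] at g1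
      rw [rewritePair_self]
      simp only [smul_mul_assoc, mul_smul_comm, map_smul, e1, map_zero] at g1 ⊢
      linear_combination (norm := module) (2⁻¹ : k) • g1

end Confluence

end OperadicLieSuperalgebra

/-! ### Global confluence and descent of the normal form to `U`. -/

namespace OperadicLieSuperalgebra

open TensorAlgebra Module

variable {k : Type u} {L : Type v} [Field k] [AddCommGroup L] [Module k L]

section Confluence

variable {B : OperadicLieSuperalgebra k L} {X : Type w} [LinearOrder X] {bas : Basis X k L}
  {par : X → ZMod 2}

/-- Rewriting either pair leaves smaller words in which the other pair is still present. Confluence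
at those words shows that both sides equal the normal form with both pairs replaced. -/
theorem normalForm_rewriteAt_disjoint {a c b : List X} {x y x' y' : X}
    (ih : ∀ v : List X, v.wordSize < (a ++ x :: y :: (c ++ x' :: y' :: b)).wordSize →
      B.IsConfluentAt bas par v)
    (h : IsReducible k par x y) (h' : IsReducible k par x' y') :
    B.normalForm bas par (B.rewriteAt bas par (a, x, y, c ++ x' :: y' :: b))
      = B.normalForm bas par (B.rewriteAt bas par (a ++ x :: y :: c, x', y', b)) := by
  have h1 : ∀ s ∈ Submodule.span k (word bas '' {v | IsSmaller x y v}),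
      B.normalForm bas par (word bas a * s * (word bas c * (word bas [x', y'] * word bas b)))
        = B.normalForm bas par (word bas a * s *
            (word bas c * (B.rewritePair bas par x' y' * word bas b))) := by
    intro s hs
    induction hs using Submodule.span_induction with
    | zero => simp
    | add s t _ _ hs ht => simp only [mul_add, add_mul, map_add, hs, ht]
    | smul r s _ hs => simp only [mul_smul_comm, smul_mul_assoc, map_smul, hs]
    | mem s hs =>
      obtain ⟨v, hv, rfl⟩ := hs
      have := (ih (a ++ (v ++ c) ++ x' :: y' :: b)
        (by simpa using hv a (c ++ x' :: y' :: b))).contextNormalForm_pair h'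
      simpa [contextNormalForm_apply, mul_assoc] using this
  have h2 : ∀ s ∈ Submodule.span k (word bas '' {v | IsSmaller x' y' v}),
      B.normalForm bas par (word bas a * word bas [x, y] * (word bas c * (s * word bas b)))
        = B.normalForm bas par (word bas a * B.rewritePair bas par x y *
            (word bas c * (s * word bas b))) := by
    intro s hs
    induction hs using Submodule.span_induction with
    | zero => simp
    | add s t _ _ hs ht => simp only [mul_add, add_mul, map_add, hs, ht]
    | smul r s _ hs => simp only [mul_smul_comm, smul_mul_assoc, map_smul, hs]
    | mem s hs =>
      obtain ⟨v, hv, rfl⟩ := hs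
      have := (ih (a ++ x :: y :: (c ++ (v ++ b)))
        (by simpa using hv (a ++ x :: y :: c) b)).contextNormalForm_pair h
      simpa [contextNormalForm_apply, mul_assoc] using this
  have e1 := h1 _ (B.rewritePair_mem bas par h)
  have e2 := h2 _ (B.rewritePair_mem bas par h')
  simpa [rewriteAt, mul_assoc] using e1.trans e2.symm

variable (hB : B.IsStrict) (hpar : ∀ x, bas x ∈ B.grading (par x))
  (hspan : ∀ a, B.grading a ≤ Submodule.span k (bas '' {x | par x = a}))
include hB hpar hspan

theorem normalForm_rewriteAt_append {w a c b b' : List X} {x y x' y' : X}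
    (ih : ∀ v : List X, v.wordSize < w.wordSize → B.IsConfluentAt bas par v)
    (h : IsRedex k par w (a, x, y, b)) (h' : IsRedex k par w (a ++ c, x', y', b')) :
    B.normalForm bas par (B.rewriteAt bas par (a, x, y, b))
      = B.normalForm bas par (B.rewriteAt bas par (a ++ c, x', y', b')) := by
  obtain ⟨rfl, h⟩ := h
  obtain ⟨e, h'⟩ := h'
  simp only [List.append_assoc, List.append_cancel_left_eq] at e
  -- `c` is the offset between the two redexes: empty means the same redex, one letter an overlap,
  -- two or more letters disjoint pairs.
  match c, e with
  | [], e => simp_all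
  | [t], e =>
    simp only [List.cons_append, List.nil_append, List.cons.injEq] at e
    obtain ⟨rfl, rfl, rfl⟩ := e
    have := contextNormalForm_overlap hB hpar hspan ih h h'
    simpa [contextNormalForm_apply, rewriteAt, mul_assoc] using this
  | t :: t' :: c, e =>
    simp only [List.cons_append, List.cons.injEq] at e
    obtain ⟨rfl, rfl, rfl⟩ := e
    exact normalForm_rewriteAt_disjoint ih h h'

theorem isConfluentAt (w : List X) : B.IsConfluentAt bas par w := by
  induction w using List.wordSize_induction with
  | h w ih =>
    intro q hq
    obtain ⟨q', hq', e⟩ := B.exists_redex_normalForm bas par (w := w) fun h => h q hq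
    rw [e]
    obtain ⟨a, x, y, b⟩ := q
    obtain ⟨a', x', y', b'⟩ := q'
    -- One of the two redexes starts no later than the other.
    rcases List.append_eq_append_iff.1 (hq.1.symm.trans hq'.1) with ⟨c, rfl, -⟩ | ⟨c, rfl, -⟩
    · exact (normalForm_rewriteAt_append hB hpar hspan ih hq hq').symm
    · exact normalForm_rewriteAt_append hB hpar hspan ih hq' hq

theorem normalForm_mul_mul (s t : TensorAlgebra k L) {c d : ZMod 2} {x y : L}
    (hx : x ∈ B.grading c) (hy : y ∈ B.grading d) :
    B.normalForm bas par (s * (ι k x * ι k y) * t)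
      = B.normalForm bas par
        (s * (koszulSign k c d • (ι k y * ι k x) + ι k (B.bracket x y)) * t) := by
  have hs : s ∈ Submodule.span k (Set.range (word bas)) := span_word bas ▸ trivial
  have ht : t ∈ Submodule.span k (Set.range (word bas)) := span_word bas ▸ trivial
  induction hs using Submodule.span_induction with
  | zero => simp
  | add s t _ _ hs ht => rw [add_mul, add_mul, map_add, hs, ht, ← map_add, ← add_mul, ← add_mul]
  | smul r s _ hs =>
    rw [smul_mul_assoc, smul_mul_assoc, map_smul, hs, ← map_smul, ← smul_mul_assoc,
      ← smul_mul_assoc]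
  | mem s hs =>
    obtain ⟨a, rfl⟩ := hs
    induction ht using Submodule.span_induction with
    | zero => simp
    | add s t _ _ hs ht => rw [mul_add, map_add, hs, ht, ← map_add, ← mul_add]
    | smul r s _ hs => rw [mul_smul_comm, map_smul, hs, ← map_smul, ← mul_smul_comm]
    | mem t ht =>
      obtain ⟨b, rfl⟩ := ht
      have := contextNormalForm_mul_mul (a := a) (b := b) hB hpar hspan
        (fun w _ => isConfluentAt hB hpar hspan w) hx hy
      rwa [← map_smul, ← map_add] at this

omit hB hpar hspan in
variable (B bas par) in
/-- The congruence on the tensor algebra of having the same normal form in every context. -/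
def normalFormCon : RingCon (TensorAlgebra k L) where
  r s t := ∀ p q, B.normalForm bas par (p * s * q) = B.normalForm bas par (p * t * q)
  iseqv := ⟨fun _ _ _ => rfl, fun h p q => (h p q).symm, fun h h' p q => (h p q).trans (h' p q)⟩
  add' h h' p q := by rw [mul_add, add_mul, map_add, h, h', ← map_add, ← add_mul, ← mul_add]
  mul' {s s' t t'} h h' p q := by
    have e1 := h p (t * q)
    have e2 := h' (p * s') q
    simp only [mul_assoc] at e1 e2 ⊢
    exact e1.trans e2

/-- `normalFormCon` is a ring congruence containing the enveloping relations, so the quotient map to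
it factors through `U`; the trivial context then recovers the normal form itself. -/
theorem normalForm_eq_of_mkAlgHom_eq {s t : TensorAlgebra k L}
    (h : RingQuot.mkAlgHom k B.EnvelopingRel s = RingQuot.mkAlgHom k B.EnvelopingRel t) :
    B.normalForm bas par s = B.normalForm bas par t := by
  let c := B.normalFormCon bas par
  let π : TensorAlgebra k L →ₐ[k] c.Quotient :=
    { c.mk' with commutes' := fun _ => rfl }
  have hπ : ∀ ⦃s t⦄, B.EnvelopingRel s t → π s = π t := by
    rintro _ _ ⟨a, b, x, y, hx, hy⟩
    exact (RingCon.eq c).2 fun p q => normalForm_mul_mul hB hpar hspan p q hx hy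
  have := congrArg (RingQuot.liftAlgHom k ⟨π, hπ⟩) h
  rw [RingQuot.liftAlgHom_mkAlgHom_apply, RingQuot.liftAlgHom_mkAlgHom_apply] at this
  simpa using (RingCon.eq c).1 this 1 1

end Confluence

/-! ### Normal forms do not lengthen words. -/

section Length

variable (B : OperadicLieSuperalgebra k L) {X : Type w} [LinearOrder X] (bas : Basis X k L)
  (par : X → ZMod 2)

/-- The span of the words of length at most `n`. -/
def wordsUpTo (n : ℕ) : Submodule k (TensorAlgebra k L) :=
  Submodule.span k (word bas '' {w | w.length ≤ n})

theorem normalForm_mem_wordsUpTo {n : ℕ} {t : TensorAlgebra k L} (ht : t ∈ wordsUpTo bas n) :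
    B.normalForm bas par t ∈ wordsUpTo bas n := by
  suffices h : ∀ w : List X, w.length ≤ n → B.normalForm bas par (word bas w) ∈ wordsUpTo bas n by
    have : wordsUpTo bas n ≤ (wordsUpTo bas n).comap (B.normalForm bas par) :=
      Submodule.span_le.2 (by rintro _ ⟨w, hw, rfl⟩; exact h w hw)
    exact this ht
  intro w
  induction w using List.wordSize_induction with
  | h w ih =>
    intro hw
    by_cases hs : IsStandard k par w
    · rw [B.normalForm_standard bas par hs]
      exact Submodule.subset_span ⟨w, hw, rfl⟩
    · obtain ⟨q, hq, e⟩ := B.exists_redex_normalForm bas par hs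
      rw [e]
      have h1 := B.rewriteAt_mem bas par hq.2
      rw [← hq.1] at h1
      have : Submodule.span k (word bas '' {v | v.wordSize < w.wordSize})
          ≤ (wordsUpTo bas n).comap (B.normalForm bas par) := by
        refine Submodule.span_le.2 ?_
        rintro _ ⟨v, hv, rfl⟩
        refine ih v hv (le_trans ?_ hw)
        rcases Prod.Lex.toLex_lt_toLex.1 hv with h | h
        · exact h.le
        · exact h.1.le
      exact this h1

end Length

end OperadicLieSuperalgebra

/-! ### Lifting filtered elements and reading off components of the associated graded algebra. -/

namespace GeneratedFiltration

variable {k : Type u} {U : Type v} [Field k] [Ring U] [Algebra k U] {V : Submodule k U}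

theorem lof_grMk_mul_grOfGen {n : ℕ} (x : filt V n) (y : V) :
    DirectSum.lof k ℕ (grPiece V) n (grMk n x) * grOfGen y
      = DirectSum.lof k ℕ (grPiece V) (n + 1)
        (grMk (n + 1) ⟨x * y, filt_mul_mem x.2 (mem_filt_one y.2)⟩) :=
  DirectSum.of_mul_of _ _

theorem grOfGen_mul_lof_grMk {n : ℕ} (x : filt V n) (y : V) :
    grOfGen y * DirectSum.lof k ℕ (grPiece V) n (grMk n x)
      = DirectSum.lof k ℕ (grPiece V) (1 + n)
        (grMk (1 + n) ⟨y * x, filt_mul_mem (mem_filt_one y.2) x.2⟩) :=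
  DirectSum.of_mul_of _ _

theorem lof_grMk_congr {m n : ℕ} (h : m = n) {x : filt V m} {y : filt V n} (hxy : (x : U) = y) :
    DirectSum.lof k ℕ (grPiece V) m (grMk m x) = DirectSum.lof k ℕ (grPiece V) n (grMk n y) := by
  subst h
  rw [Subtype.ext hxy]

/-- Meant for the tensor algebra filtered by word length: elements of `U_n` then lift to
combinations of words of length at most `n`. -/
theorem exists_preimage_of_mem_filt {T : Type w} [Ring T] [Algebra k T] (f : T →ₐ[k] U)
    (W : ℕ → Submodule k T) (h1 : ∀ n, 1 ∈ W n) (hmul : ∀ n, W n * W 1 ≤ W (n + 1))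
    (hV : ∀ x ∈ V, ∃ t ∈ W 1, f t = x) (n : ℕ) {x : U} (hx : x ∈ filt V n) :
    ∃ t ∈ W n, f t = x := by
  suffices h : filt V n ≤ (W n).map f.toLinearMap from h hx
  clear hx
  induction n with
  | zero =>
    rw [filt, pow_zero, Submodule.one_le]
    exact ⟨1, h1 0, map_one f⟩
  | succ n ih =>
    rw [filt, pow_succ]
    have h : 1 ⊔ V ≤ (W 1).map f.toLinearMap :=
      sup_le (Submodule.one_le.2 ⟨1, h1 1, map_one f⟩) hV
    refine (mul_le_mul' ih h).trans ?_
    rw [← Submodule.map_mul]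
    exact Submodule.map_mono (hmul n)

/-- A linear relation among symbols in `gr U` holds in each degree separately, and a vanishing
symbol in degree `n` means membership in `U_{n-1}`. -/
theorem linearCombination_filter_mem_filtPred {W : Type w} {len : W → ℕ} {u : W → U}
    (hu : ∀ x, u x ∈ filt V (len x)) {c : W →₀ k}
    (hc : Finsupp.linearCombination k
      (fun x => DirectSum.lof k ℕ (grPiece V) (len x) (grMk (len x) ⟨u x, hu x⟩)) c = 0) (n : ℕ) :
    Finsupp.linearCombination k u (c.filter fun x => len x = n) ∈ filtPred V n := by
  classical
  -- The value `0` matches both the vanishing degree-`n` component of symbols of other degrees and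
  -- their removal by the filter.
  let y (x : W) : filt V n := if h : len x = n then ⟨u x, h ▸ hu x⟩ else 0
  have hy : ∀ x, DirectSum.component k ℕ (grPiece V) n
      (DirectSum.lof k ℕ (grPiece V) (len x) (grMk (len x) ⟨u x, hu x⟩)) = grMk n (y x) := by
    intro x
    by_cases h : len x = n
    · subst h
      rw [DirectSum.component.lof_self]
      simp [y]
    · rw [DirectSum.component.of, dif_neg h]
      simp [y, h]
  have h0 : grMk n (Finsupp.linearCombination k y c) = 0 := by
    have := congrArg (DirectSum.component k ℕ (grPiece V) n) hc
    rw [map_zero, Finsupp.linearCombination_apply, map_finsuppSum] at this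
    rw [← this, Finsupp.linearCombination_apply, map_finsuppSum]
    refine Finsupp.sum_congr fun v _ => ?_
    rw [map_smul, map_smul, hy]
  have h1 := (Submodule.Quotient.mk_eq_zero ((filtPred V n).submoduleOf _)).1 h0
  have h2 : ((Finsupp.linearCombination k y c : filt V n) : U)
      = Finsupp.linearCombination k u (c.filter fun x => len x = n) := by
    rw [Finsupp.linearCombination_apply, Finsupp.linearCombination_apply,
      Finsupp.sum_filter_index, Finsupp.sum, AddSubmonoidClass.coe_finsetSum,
      Finsupp.support_filter, Finset.sum_filter]
    refine Finset.sum_congr rfl fun x _ => ?_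
    by_cases h : len x = n <;> simp [y, h]
  rw [← h2]
  exact h1

end GeneratedFiltration

namespace OperadicLieSuperalgebra

open TensorAlgebra Module GeneratedFiltration

variable {k : Type u} {L : Type v} [Field k] [AddCommGroup L] [Module k L]

/-! ### Surjectivity of `η`. -/

section Surjective

variable (B : OperadicLieSuperalgebra k L)

theorem lof_grMk_mem_range (n : ℕ) (x : filt (LinearMap.range B.envι) n) :
    DirectSum.lof k ℕ (grPiece (LinearMap.range B.envι)) n (grMk n x) ∈ B.eta.range := by
  induction n with
  | zero =>
    obtain ⟨x, hx⟩ := x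
    have hx' := hx
    rw [filt, pow_zero, Submodule.mem_one] at hx'
    obtain ⟨c, rfl⟩ := hx'
    exact ⟨algebraMap k _ c, AlgHom.commutes B.eta c⟩
  | succ n ih =>
    obtain ⟨x, hx⟩ := x
    have hx' := hx
    rw [filt, pow_succ] at hx'
    induction hx' using Submodule.mul_induction_on' with
    | mem_mul_mem m hm y hy =>
      obtain ⟨a, ha, v, hv, rfl⟩ := Submodule.mem_sup.1 hy
      have h0 : m * a ∈ filt (LinearMap.range B.envι) n := by
        have := Submodule.mul_mem_mul hm ha
        rwa [mul_one] at this
      -- The scalar `a` contributes `m * a`, which stays in `U_n` and so has zero class in degree `n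
      -- + 1`.
      have h1 : grMk (n + 1) ⟨m * (a + v), hx⟩
          = grMk (n + 1) ⟨m * v, filt_mul_mem hm (mem_filt_one hv)⟩ := by
        rw [← sub_eq_zero, ← map_sub]
        refine grMk_eq_zero ?_
        change m * (a + v) - m * v ∈ filt _ n
        rwa [mul_add, add_sub_cancel_right]
      rw [h1]
      obtain ⟨y, rfl⟩ := hv
      rw [← lof_grMk_mul_grOfGen ⟨m, hm⟩ ⟨_, y, rfl⟩]
      exact mul_mem (ih ⟨m, hm⟩) ⟨B.symι y, B.eta_symι y⟩
    | add s hs t ht h h' =>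
      have hs' : s ∈ filt (LinearMap.range B.envι) (n + 1) := by rwa [filt, pow_succ]
      have ht' : t ∈ filt (LinearMap.range B.envι) (n + 1) := by rwa [filt, pow_succ]
      have := add_mem (h hs') (h' ht')
      rwa [← map_add, ← map_add] at this

theorem eta_surjective : Function.Surjective B.eta := by
  intro x
  change x ∈ B.eta.range
  induction x using DirectSum.induction_on with
  | zero => exact zero_mem _
  | of n x =>
    obtain ⟨x, rfl⟩ := grMk_surjective n x
    exact B.lof_grMk_mem_range n x
  | add x y hx hy => exact add_mem hx hy

end Surjective

/-! ### Word length and the filtration of `U`. -/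

section WordFiltration

variable (B : OperadicLieSuperalgebra k L) {X : Type w} (bas : Basis X k L)

theorem mkAlgHom_word_mem_filt (w : List X) :
    RingQuot.mkAlgHom k B.EnvelopingRel (word bas w)
      ∈ filt (LinearMap.range B.envι) w.length := by
  induction w with
  | nil => rw [word_nil, map_one]; exact one_mem_filt
  | cons x w ih =>
    rw [word_cons, map_mul, List.length_cons, add_comm]
    exact filt_mul_mem (mem_filt_one ⟨bas x, rfl⟩) ih

theorem eta_mkAlgHom_word (w : List X) :
    B.eta (RingQuot.mkAlgHom k B.SymmetricRel (word bas w))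
      = DirectSum.lof k ℕ (grPiece (LinearMap.range B.envι)) w.length
          (grMk w.length ⟨_, B.mkAlgHom_word_mem_filt bas w⟩) := by
  induction w with
  | nil =>
    refine Eq.trans ?_ (lof_grMk_congr (x := ⟨1, one_mem_filt⟩) rfl ?_)
    · rw [word_nil, map_one, map_one]
      rfl
    · exact (map_one (RingQuot.mkAlgHom k B.EnvelopingRel)).symm
  | cons x w ih =>
    have e : RingQuot.mkAlgHom k B.SymmetricRel (word bas (x :: w))
        = B.symι (bas x) * RingQuot.mkAlgHom k B.SymmetricRel (word bas w) := by
      rw [word_cons, map_mul]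
      rfl
    rw [e, map_mul, ih, eta_symι]
    refine (grOfGen_mul_lof_grMk _ (B.envι.rangeRestrict (bas x))).trans ?_
    refine lof_grMk_congr (add_comm _ _) ?_
    exact (map_mul (RingQuot.mkAlgHom k B.EnvelopingRel) _ _).symm

theorem wordsUpTo_mul (m n : ℕ) : wordsUpTo bas m * wordsUpTo bas n ≤ wordsUpTo bas (m + n) := by
  rw [wordsUpTo, wordsUpTo, Submodule.span_mul_span, Submodule.span_le]
  rintro _ ⟨_, ⟨v, hv, rfl⟩, _, ⟨w, hw, rfl⟩, rfl⟩
  exact Submodule.subset_span ⟨v ++ w, by simpa using Nat.add_le_add hv hw, by simp⟩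

theorem exists_mem_wordsUpTo {n : ℕ} {x : B.Enveloping}
    (hx : x ∈ filt (LinearMap.range B.envι) n) :
    ∃ t ∈ wordsUpTo bas n, RingQuot.mkAlgHom k B.EnvelopingRel t = x := by
  have h1 : ∀ n, (1 : TensorAlgebra k L) ∈ wordsUpTo bas n := fun n =>
    Submodule.subset_span ⟨[], n.zero_le, rfl⟩
  have hV : ∀ x ∈ LinearMap.range B.envι,
      ∃ t ∈ wordsUpTo bas 1, RingQuot.mkAlgHom k B.EnvelopingRel t = x := by
    rintro _ ⟨x, rfl⟩
    have h : {v : List X | v.length = 1} ⊆ {v | v.length ≤ 1} := fun v (hv : v.length = 1) => hv.le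
    exact ⟨ι k x, Submodule.span_mono (Set.image_mono h) (ι_mem_span_word bas x), rfl⟩
  exact exists_preimage_of_mem_filt (RingQuot.mkAlgHom k B.EnvelopingRel) (wordsUpTo bas) h1
    (fun n => wordsUpTo_mul bas n 1) hV n hx

end WordFiltration

/-! ### Standard words and injectivity of `η`. -/

section Injective

/-- Sorting terminates as before, without bracket terms. A repeated letter whose sign is not `1`
makes the image equal to its negative, hence zero since the characteristic is not 2. -/
theorem map_word_mem_span_standard {X : Type w} [LinearOrder X] (bas : Basis X k L)
    (par : X → ZMod 2) {S : Type*} [Ring S] [Algebra k S] (f : TensorAlgebra k L →ₐ[k] S)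
    (hf : ∀ x y, f (ι k (bas x) * ι k (bas y))
      = koszulSign k (par x) (par y) • f (ι k (bas y) * ι k (bas x))) (w : List X) :
    f (word bas w) ∈ Submodule.span k ((fun v => f (word bas v)) '' {v | IsStandard k par v}) := by
  induction w using List.wordSize_induction with
  | h w ih =>
    by_cases hw : IsStandard k par w
    · exact Submodule.subset_span ⟨w, hw, rfl⟩
    · simp only [IsStandard, not_forall, not_not] at hw
      obtain ⟨⟨a, x, y, b⟩, rfl, h⟩ := hw
      simp only at h ih ⊢
      have e : f (word bas (a ++ x :: y :: b))
          = koszulSign k (par x) (par y) • f (word bas (a ++ y :: x :: b)) := by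
        have := congrArg (fun t => f (word bas a) * t * f (word bas b)) (hf x y)
        simpa [mul_assoc] using this
      rcases h with h | ⟨rfl, h⟩
      · rw [e]
        exact Submodule.smul_mem _ _ (ih _ (List.wordSize_swap a b h))
      · rw [eq_zero_of_eq_koszulSign_smul h e]
        exact zero_mem _

variable (B : OperadicLieSuperalgebra k L) {X : Type w} [LinearOrder X] {bas : Basis X k L}
  {par : X → ZMod 2}
  (hB : B.IsStrict) (hpar : ∀ x, bas x ∈ B.grading (par x))
  (hspan : ∀ a, B.grading a ≤ Submodule.span k (bas '' {x | par x = a}))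

include hB hpar hspan

/-- `t` is its own normal form, but it is also the normal form of a lift of length below `n`. Since
normalization does not lengthen words, the two supports are disjoint. -/
theorem eq_zero_of_mkAlgHom_mem_filtPred {n : ℕ} {t : TensorAlgebra k L}
    (ht : t ∈ Submodule.span k (word bas '' {w | IsStandard k par w ∧ w.length = n}))
    (h : RingQuot.mkAlgHom k B.EnvelopingRel t ∈ filtPred (LinearMap.range B.envι) n) : t = 0 := by
  have hN : B.normalForm bas par t = t := by
    clear h
    induction ht using Submodule.span_induction with
    | zero => simp
    | add s t _ _ hs ht => rw [map_add, hs, ht]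
    | smul c s _ hs => rw [map_smul, hs]
    | mem s hs =>
      obtain ⟨w, hw, rfl⟩ := hs
      exact B.normalForm_standard bas par hw.1
  cases n with
  | zero =>
    rw [← hN, normalForm_eq_of_mkAlgHom_eq hB hpar hspan (t := 0), map_zero]
    rw [map_zero]
    exact (Submodule.mem_bot k).1 h
  | succ n =>
    obtain ⟨t', ht', e⟩ := B.exists_mem_wordsUpTo bas h
    have e' := normalForm_eq_of_mkAlgHom_eq hB hpar hspan e
    have h2 := B.normalForm_mem_wordsUpTo bas par ht'
    rw [e', hN] at h2
    rw [← (wordBasis bas).repr.map_eq_zero_iff]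
    ext v
    by_contra hv
    have l1 := (repr_support bas ht hv).2
    have l2 : v.length ≤ n := repr_support bas h2 hv
    omega

theorem eta_injective : Function.Injective B.eta := by
  classical
  rw [injective_iff_map_eq_zero]
  intro s hs
  have hspan' : s ∈ Submodule.span k
      ((fun v => RingQuot.mkAlgHom k B.SymmetricRel (word bas v)) '' {v | IsStandard k par v}) := by
    obtain ⟨t, rfl⟩ := RingQuot.mkAlgHom_surjective k B.SymmetricRel s
    have ht : t ∈ Submodule.span k (Set.range (word bas)) := span_word bas ▸ trivial
    clear hs
    induction ht using Submodule.span_induction with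
    | zero => rw [map_zero]; exact zero_mem _
    | add s t _ _ hs ht => rw [map_add]; exact add_mem hs ht
    | smul c s _ hs => rw [map_smul]; exact Submodule.smul_mem _ _ hs
    | mem s hs =>
      obtain ⟨w, rfl⟩ := hs
      refine map_word_mem_span_standard bas par _ (fun x y => ?_) w
      rw [RingQuot.mkAlgHom_rel k (SymmetricRel.intro (B := B) _ _ _ _ (hpar x) (hpar y)),
        map_smul]
  obtain ⟨c, hc, rfl⟩ := (Finsupp.mem_span_image_iff_linearCombination k).1 hspan'
  -- The kernel relation is split by word length, because the independence statement handles one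
  -- length at a time.
  have key : ∀ n, Finsupp.linearCombination k (word bas) (c.filter fun w => w.length = n) = 0 := by
    intro n
    refine B.eq_zero_of_mkAlgHom_mem_filtPred hB hpar hspan (n := n) ?_ ?_
    · refine (Finsupp.mem_span_image_iff_linearCombination k).2 ⟨_, ?_, rfl⟩
      intro v hv
      rw [Finsupp.support_filter, Finset.coe_filter] at hv
      exact ⟨hc hv.1, hv.2⟩
    · rw [← AlgHom.toLinearMap_apply, Finsupp.apply_linearCombination]
      refine linearCombination_filter_mem_filtPred (B.mkAlgHom_word_mem_filt bas) ?_ n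
      rw [← hs, ← AlgHom.toLinearMap_apply, Finsupp.apply_linearCombination]
      congr 2
      exact funext fun w => (B.eta_mkAlgHom_word bas w).symm
  suffices h : c = 0 by rw [h, map_zero]
  ext v
  have := congrArg (fun t => (wordBasis bas).repr t v) (key v.length)
  rw [show word bas = wordBasis bas from funext fun w => (wordBasis_apply bas w).symm] at this
  simpa using this

end Injective

theorem exists_homogeneous_basis (B : OperadicLieSuperalgebra k L) :
    ∃ (X : Type v) (bas : Basis X k L) (par : X → ZMod 2), (∀ x, bas x ∈ B.grading (par x)) ∧
      ∀ a, B.grading a ≤ Submodule.span k (bas '' {x | par x = a}) := by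
  have hint : DirectSum.IsInternal B.grading :=
    (DirectSum.isInternal_submodule_iff_isCompl B.grading (zero_ne_one (α := ZMod 2))
      (by ext x; revert x; decide)).2 B.isCompl_grading
  let bs := fun a => Basis.ofVectorSpace k (B.grading a)
  refine ⟨_, hint.collectedBasis bs, Sigma.fst, fun x => hint.collectedBasis_mem bs x, ?_⟩
  intro a x hx
  have : (⟨x, hx⟩ : B.grading a) ∈ (⊤ : Submodule k (B.grading a)) := trivial
  rw [← (bs a).span_eq] at this
  have h2 := Submodule.mem_map_of_mem (f := (B.grading a).subtype) this
  rw [Submodule.map_span] at h2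
  refine Submodule.span_mono ?_ h2
  rintro _ ⟨_, ⟨i, rfl⟩, rfl⟩
  exact ⟨⟨a, i⟩, rfl, by rw [hint.collectedBasis_coe]; rfl⟩

/-- The Poincaré–Birkhoff–Witt theorem. -/
theorem IsStrict.isPBW {B : OperadicLieSuperalgebra k L} (hB : B.IsStrict) : B.IsPBW := by
  obtain ⟨X, bas, par, hpar, hspan⟩ := B.exists_homogeneous_basis
  classical
  -- Any linear order would serve: termination rests on length and inversions, not on
  -- well-foundedness of the order on letters.
  let : LinearOrder X := linearOrderOfSTO WellOrderingRel
  exact ⟨B.eta_injective hB hpar hspan, B.eta_surjective⟩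

end OperadicLieSuperalgebra

/-! ### Centrality and additivity of the defects `[x, x]` and `[[x, x], x]`. -/

namespace OperadicLieSuperalgebra

variable {k : Type u} {L : Type v} [Field k] [AddCommGroup L] [Module k L]
  (B : OperadicLieSuperalgebra k L)

theorem exists_add_homogeneous (x : L) :
    ∃ x₀ ∈ B.grading 0, ∃ x₁ ∈ B.grading 1, x₀ + x₁ = x :=
  Submodule.mem_sup.1 (B.isCompl_grading.sup_eq_top ▸ Submodule.mem_top)

theorem eq_of_eq_on_homogeneous {M : Type w} [AddCommGroup M] [Module k M] {f g : L →ₗ[k] M}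
    (h : ∀ a, ∀ x ∈ B.grading a, f x = g x) (x : L) : f x = g x := by
  obtain ⟨x₀, h₀, x₁, h₁, rfl⟩ := B.exists_add_homogeneous x
  rw [map_add, map_add, h 0 x₀ h₀, h 1 x₁ h₁]

variable {B}

theorem bracket_comm {a b : ZMod 2} {x y : L} (hx : x ∈ B.grading a) (hy : y ∈ B.grading b) :
    B.bracket y x = -(koszulSign k a b • B.bracket x y) := by
  rw [eq_neg_iff_add_eq_zero, koszulSign_comm]
  exact B.skew _ _ _ _ hy hx

theorem leibniz {a b : ZMod 2} {x y : L} (hx : x ∈ B.grading a) (hy : y ∈ B.grading b) (z : L) :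
    B.bracket x (B.bracket y z)
      = B.bracket (B.bracket x y) z + koszulSign k a b • B.bracket y (B.bracket x z) := by
  refine B.eq_of_eq_on_homogeneous (f := B.bracket x ∘ₗ B.bracket y)
    (g := B.bracket (B.bracket x y) + koszulSign k a b • B.bracket y ∘ₗ B.bracket x) ?_ z
  intro c z hz
  simp only [LinearMap.comp_apply, LinearMap.add_apply, LinearMap.smul_apply]
  have j := B.jacobi _ _ _ _ _ _ hx hy hz
  rw [bracket_comm hx (B.bracket_mem _ _ _ _ hy hz), bracket_comm hx hz, map_neg, map_smul,
    LinearMap.neg_apply, LinearMap.smul_apply,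
    bracket_comm hy (B.bracket_mem _ _ _ _ hx hz)] at j
  simp only [koszulSign_add_right, koszulSign_comm c a, koszulSign_comm c b,
    koszulSign_comm b a] at j
  have e1 := koszulSign_eq_one_or k a b
  have e2 := koszulSign_eq_one_or k a c
  have e3 := koszulSign_eq_one_or k b c
  generalize koszulSign k a b = s1 at *
  generalize koszulSign k a c = s2 at *
  generalize koszulSign k b c = s3 at *
  linear_combination (norm := skip) -j
  rcases e1 with rfl | rfl <;> rcases e2 with rfl | rfl <;> rcases e3 with rfl | rfl <;> module

/-- In the Leibniz rule with both derivations equal to `ad x` and sign `1`, the terms `[x, [x, y]]`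
cancel. -/
theorem bracket_self_bracket {a : ZMod 2} {x : L} (hx : x ∈ B.grading a)
    (ha : koszulSign k a a = 1) (y : L) : B.bracket (B.bracket x x) y = 0 := by
  have := leibniz hx hx y
  rwa [ha, one_smul, eq_comm, add_eq_right] at this

/-- With sign `-1`, Leibniz gives `ad [x, x] = 2 (ad x)²`, which commutes with `ad x`; their
commutator is `ad [[x, x], x]`. -/
theorem bracket_bracket_self_bracket {a : ZMod 2} {x : L} (hx : x ∈ B.grading a)
    (ha : koszulSign k a a ≠ 1) (y : L) :
    B.bracket (B.bracket (B.bracket x x) x) y = 0 := by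
  have ha := (koszulSign_eq_one_or k a a).resolve_left ha
  have h : ∀ y, B.bracket (B.bracket x x) y
      = B.bracket x (B.bracket x y) + B.bracket x (B.bracket x y) := by
    intro y
    have := leibniz hx hx y
    rw [ha] at this
    linear_combination (norm := module) -this
  have h2 := leibniz (B.bracket_mem _ _ _ _ hx hx) hx y
  rw [koszulSign_add_left, ha, h (B.bracket x y), h y, map_add] at h2
  linear_combination (norm := module) -h2

theorem bracket_eq_zero_of_central {a : ZMod 2} {z : L} (hz : z ∈ B.grading a)
    (h : ∀ y, B.bracket z y = 0) (y : L) : B.bracket y z = 0 := by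
  refine B.eq_of_eq_on_homogeneous (f := B.bracket.flip z) (g := 0) (fun b y hy => ?_) y
  rw [LinearMap.flip_apply, bracket_comm hz hy, h, smul_zero, neg_zero, LinearMap.zero_apply]

theorem bracket_self_add {a : ZMod 2} {x y : L} (hx : x ∈ B.grading a) (hy : y ∈ B.grading a)
    (ha : koszulSign k a a = 1) :
    B.bracket (x + y) (x + y) = B.bracket x x + B.bracket y y := by
  have := B.skew _ _ _ _ hx hy
  rw [ha, one_smul] at this
  simp only [map_add, LinearMap.add_apply]
  linear_combination (norm := module) this

/-- The mixed terms of the cube are the Jacobi sums of `(x, x, y)` and of `(x, y, y)`. -/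
theorem bracket_bracket_self_add {a : ZMod 2} {x y : L} (hx : x ∈ B.grading a)
    (hy : y ∈ B.grading a) :
    B.bracket (B.bracket (x + y) (x + y)) (x + y)
      = B.bracket (B.bracket x x) x + B.bracket (B.bracket y y) y := by
  have h1 := B.jacobi _ _ _ _ _ _ hx hx hy
  have h2 := B.jacobi _ _ _ _ _ _ hx hy hy
  have h0 : koszulSign k a (a + a) = 1 := by
    simp [CharTwo.add_self_eq_zero, koszulSign]
  rw [h0] at h1 h2
  simp only [map_add, LinearMap.add_apply]
  linear_combination (norm := module) h1 + h2

theorem apply_mem_of_mem_span {B : OperadicLieSuperalgebra k L} {S T : Set L} {N : Submodule k L}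
    (h : ∀ s ∈ S, ∀ t ∈ T, B.bracket s t ∈ N) {x y : L} (hx : x ∈ Submodule.span k S)
    (hy : y ∈ Submodule.span k T) : B.bracket x y ∈ N := by
  have h1 := Submodule.apply_mem_map₂ B.bracket hx hy
  rw [Submodule.map₂_span_span] at h1
  exact Submodule.span_le.2 (Set.image2_subset_iff.2 h) h1

/-! ### Generated subalgebras and brackets acting on them. -/

section Generated

variable {ι : Type w}

variable (B) in
/-- The nonassociative words in a family of elements. -/
inductive IsBracketWord (u : ι → L) : L → Prop
  | of (i : ι) : IsBracketWord u (u i)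
  | bracket (x y : L) (hx : IsBracketWord u x) (hy : IsBracketWord u y) :
      IsBracketWord u (B.bracket x y)

variable (B) in
/-- The subalgebra generated by a family of elements. -/
def bracketSpan (u : ι → L) : Submodule k L := Submodule.span k {x | B.IsBracketWord u x}

variable {u : ι → L}

theorem bracket_mem_bracketSpan {x y : L} (hx : x ∈ B.bracketSpan u) (hy : y ∈ B.bracketSpan u) :
    B.bracket x y ∈ B.bracketSpan u :=
  apply_mem_of_mem_span (fun s hs t ht => Submodule.subset_span (IsBracketWord.bracket s t hs ht))
    hx hy

theorem IsBracketWord.exists_mem_degree {D : ℤ → Submodule k L} {S : ℤ → Prop}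
    (hD : ∀ m n x y, x ∈ D m → y ∈ D n → B.bracket x y ∈ D (m + n))
    (hS : ∀ m n, S m → S n → S (m + n)) (hu : ∀ i, ∃ n, S n ∧ u i ∈ D n) {x : L}
    (hx : B.IsBracketWord u x) : ∃ n, S n ∧ x ∈ D n := by
  induction hx with
  | of i => exact hu i
  | bracket x y _ _ hx hy =>
    obtain ⟨m, hm, hx⟩ := hx
    obtain ⟨n, hn, hy⟩ := hy
    exact ⟨m + n, hS m n hm hn, hD m n x y hx hy⟩

variable (hu : ∀ i, ∃ a, u i ∈ B.grading a)
include hu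

theorem IsBracketWord.exists_mem_grading {x : L} (hx : B.IsBracketWord u x) :
    ∃ a, x ∈ B.grading a := by
  induction hx with
  | of i => exact hu i
  | bracket x y _ _ hx hy =>
    obtain ⟨a, hx⟩ := hx
    obtain ⟨b, hy⟩ := hy
    exact ⟨_, B.bracket_mem a b x y hx hy⟩

/-- Bracketing with an even element is a derivation, so its effect on generators decides. -/
theorem bracket_even_mem_bracketSpan {c : L} (hc : c ∈ B.grading 0)
    (hcu : ∀ i, B.bracket c (u i) ∈ B.bracketSpan u) {x : L} (hx : x ∈ B.bracketSpan u) :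
    B.bracket c x ∈ B.bracketSpan u := by
  suffices h : ∀ x, B.IsBracketWord u x → B.bracket c x ∈ B.bracketSpan u from
    (Submodule.span_le (p := (B.bracketSpan u).comap (B.bracket c))).2 h hx
  intro x hx
  induction hx with
  | of i => exact hcu i
  | bracket x y hx hy ihx ihy =>
    obtain ⟨a, ha⟩ := hx.exists_mem_grading hu
    rw [leibniz hc ha]
    exact add_mem (bracket_mem_bracketSpan ihx (Submodule.subset_span hy))
      (Submodule.smul_mem _ _ (bracket_mem_bracketSpan (Submodule.subset_span hx) ihy))

/-- Used with `C` the image of `𝔥`, `u` the `e_i` and `v` some `f_j`, or with `e` and `f` exchanged.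
On a product, Leibniz leaves brackets of a factor with an element of `C`, and these return to the
subalgebra, so `C` itself is reached only from generators. -/
theorem bracket_mem_bracketSpan_sup {C : Submodule k L} (hC : C ≤ B.grading 0)
    (hCu : ∀ c ∈ C, ∀ i, B.bracket c (u i) ∈ B.bracketSpan u) {b : ZMod 2} {v : L}
    (hv : v ∈ B.grading b) (hvu : ∀ i, B.bracket v (u i) ∈ C) {x : L}
    (hx : x ∈ B.bracketSpan u) : B.bracket v x ∈ B.bracketSpan u ⊔ C := by
  suffices h : ∀ x, B.IsBracketWord u x → B.bracket v x ∈ B.bracketSpan u ⊔ C from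
    (Submodule.span_le (p := (B.bracketSpan u ⊔ C).comap (B.bracket v))).2 h hx
  intro x hx
  induction hx with
  | of i => exact Submodule.mem_sup_right (hvu i)
  | bracket x y hx hy ihx ihy =>
    obtain ⟨a, ha⟩ := hx.exists_mem_grading hu
    obtain ⟨p, hp, c, hc, e⟩ := Submodule.mem_sup.1 ihx
    obtain ⟨p', hp', c', hc', e'⟩ := Submodule.mem_sup.1 ihy
    have hx' := Submodule.subset_span (R := k) hx
    have hy' := Submodule.subset_span (R := k) hy
    rw [leibniz hv ha, ← e, ← e', map_add, map_add, LinearMap.add_apply,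
      bracket_comm (hC hc') ha]
    refine Submodule.mem_sup_left (add_mem (add_mem (bracket_mem_bracketSpan hp hy')
      (bracket_even_mem_bracketSpan hu (hC hc) (hCu c hc) hy')) (Submodule.smul_mem _ _
      (add_mem (bracket_mem_bracketSpan hx' hp') (neg_mem (Submodule.smul_mem _ _
      (bracket_even_mem_bracketSpan hu (hC hc') (hCu c' hc') hx'))))))

end Generated

end OperadicLieSuperalgebra

namespace Contragredient

open OperadicLieSuperalgebra

/-! ### The `ℤ`-grading descends to `𝔤̃(A, p)`. -/

section Projection

variable (k : Type u) [Field k] {X : Type w} (φ : X → ℤ)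

/-- The projection of the free nonassociative algebra to the component of weight `n`. -/
def weightProj (n : ℤ) :
    FreeNonUnitalNonAssocAlgebra k X →ₗ[k] FreeNonUnitalNonAssocAlgebra k X where
  toFun x := MonoidAlgebra.ofCoeff (x.coeff.filter fun m => weight φ m = n)
  map_add' x y := by rw [MonoidAlgebra.coeff_add, Finsupp.filter_add]; rfl
  map_smul' c x := by rw [MonoidAlgebra.coeff_smul, Finsupp.filter_smul]; rfl

theorem weightProj_single (n : ℤ) (m : FreeMagma X) (c : k) :
    weightProj k φ n (MonoidAlgebra.single m c)
      = if weight φ m = n then MonoidAlgebra.single m c else 0 := by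
  change MonoidAlgebra.ofCoeff (Finsupp.filter _ (Finsupp.single m c)) = _
  split_ifs with h
  · rw [Finsupp.filter_single_of_pos (fun m => weight φ m = n) h]; rfl
  · rw [Finsupp.filter_single_of_neg (fun m => weight φ m = n) h]; rfl

theorem weightProj_of_mem {m n : ℤ} {x : FreeNonUnitalNonAssocAlgebra k X}
    (hx : x ∈ freeComponent k φ m) : weightProj k φ n x = if m = n then x else 0 := by
  induction hx using Submodule.span_induction with
  | zero => simp
  | add x y _ _ hx hy => rw [map_add, hx, hy]; split_ifs <;> simp
  | smul c x _ hx => rw [map_smul, hx]; split_ifs <;> simp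
  | mem x hx =>
    obtain ⟨w, hw, rfl⟩ := hx
    rw [Set.mem_ofPred_eq] at hw
    rw [weightProj_single, hw]

variable {G : Type v} [Add G] in
theorem weight_mul (φ : X → G) (m n : FreeMagma X) :
    weight φ (m * n) = weight φ m + weight φ n := rfl

variable {G : Type v} [Add G] in
theorem single_mem_freeComponent (φ : X → G) (m : FreeMagma X) :
    MonoidAlgebra.single m (1 : k) ∈ freeComponent k φ (weight φ m) :=
  Submodule.subset_span ⟨m, rfl, rfl⟩

theorem weightProj_single_mul (n : ℤ) (m : FreeMagma X) (c : k)
    (y : FreeNonUnitalNonAssocAlgebra k X) :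
    weightProj k φ n (MonoidAlgebra.single m c * y)
      = MonoidAlgebra.single m c * weightProj k φ (n - weight φ m) y := by
  induction y using MonoidAlgebra.induction_linear with
  | zero => simp
  | add x y hx hy => rw [mul_add, map_add, map_add, mul_add, hx, hy]
  | single m' c' =>
    rw [MonoidAlgebra.single_mul_single, weightProj_single, weightProj_single, weight_mul]
    by_cases h' : weight φ m' = n - weight φ m
    · rw [if_pos (by omega), if_pos h', MonoidAlgebra.single_mul_single]
    · rw [if_neg (by omega), if_neg h', mul_zero]

theorem weightProj_mul_single (n : ℤ) (m : FreeMagma X) (c : k)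
    (y : FreeNonUnitalNonAssocAlgebra k X) :
    weightProj k φ n (y * MonoidAlgebra.single m c)
      = weightProj k φ (n - weight φ m) y * MonoidAlgebra.single m c := by
  induction y using MonoidAlgebra.induction_linear with
  | zero => simp
  | add x y hx hy => rw [add_mul, map_add, map_add, add_mul, hx, hy]
  | single m' c' =>
    rw [MonoidAlgebra.single_mul_single, weightProj_single, weightProj_single, weight_mul]
    by_cases h' : weight φ m' = n - weight φ m
    · rw [if_pos (by omega), if_pos h', MonoidAlgebra.single_mul_single]
    · rw [if_neg (by omega), if_neg h', zero_mul]

end Projection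

variable {k : Type u} [Field k] {θ : ℕ} {A : Matrix (Fin θ) (Fin θ) k}
  {𝔥 : Type w} [AddCommGroup 𝔥] [Module k 𝔥] (R : Realization A 𝔥) (p : Fin θ → ZMod 2)

/-- The elements all of whose components lie in the ideal of relations. -/
def gradedRelIdeal : Submodule k (FreeAlg k θ 𝔥) :=
  ⨅ n, (relIdeal R p).comap (weightProj k genDegree n)

variable {R p}

theorem mem_gradedRelIdeal_of_mem {x : FreeAlg k θ 𝔥} {m : ℤ} (hx : x ∈ relIdeal R p)
    (hm : x ∈ freeComponent k genDegree m) : x ∈ gradedRelIdeal R p := by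
  refine (Submodule.mem_iInf _).2 fun n => ?_
  rw [Submodule.mem_comap, weightProj_of_mem k genDegree hm]
  split_ifs
  · exact hx
  · exact zero_mem _

/-- Parity-homogeneous elements may mix `ℤ`-degrees, so this relator need not be `ℤ`-homogeneous. It
is bilinear, and on monomials it is homogeneous for both gradings. -/
theorem skew_mem_gradedRelIdeal {a b : ZMod 2} {x y : FreeAlg k θ 𝔥}
    (hx : x ∈ freeComponent k (genParity p) a) (hy : y ∈ freeComponent k (genParity p) b) :
    x * y + koszulSign k a b • (y * x) ∈ gradedRelIdeal R p := by
  induction hx using Submodule.span_induction with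
  | zero => simp
  | add x x' _ _ h h' =>
    convert add_mem h h' using 1
    simp only [add_mul, mul_add]
    module
  | smul c x _ h =>
    convert Submodule.smul_mem _ c h using 1
    simp only [smul_mul_assoc, mul_smul_comm]
    module
  | mem x hx =>
    obtain ⟨m, rfl, rfl⟩ := hx
    induction hy using Submodule.span_induction with
    | zero => simp
    | add x x' _ _ h h' =>
      convert add_mem h h' using 1
      simp only [add_mul, mul_add]
      module
    | smul c x _ h =>
      convert Submodule.smul_mem _ c h using 1
      simp only [smul_mul_assoc, mul_smul_comm]
      module
    | mem y hy =>
      obtain ⟨n, rfl, rfl⟩ := hy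
      have mulm := freeComponent_mul_mem k (genDegree (θ := θ) (𝔥 := 𝔥))
      have h1 := single_mem_freeComponent k (genParity (𝔥 := 𝔥) p) m
      have h2 := single_mem_freeComponent k (genParity (𝔥 := 𝔥) p) n
      have d1 := single_mem_freeComponent k (genDegree (θ := θ) (𝔥 := 𝔥)) m
      have d2 := single_mem_freeComponent k (genDegree (θ := θ) (𝔥 := 𝔥)) n
      refine mem_gradedRelIdeal_of_mem (relator_mem R p (Relator.skew _ _ _ _ h1 h2))
        (add_mem (mulm _ _ _ _ d1 d2) (Submodule.smul_mem _ _ ?_))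
      rw [add_comm]
      exact mulm _ _ _ _ d2 d1

theorem jacobi_mem_gradedRelIdeal {a b c : ZMod 2} {x y z : FreeAlg k θ 𝔥}
    (hx : x ∈ freeComponent k (genParity p) a) (hy : y ∈ freeComponent k (genParity p) b)
    (hz : z ∈ freeComponent k (genParity p) c) :
    (x * y) * z + koszulSign k a (b + c) • ((y * z) * x)
      + koszulSign k c (a + b) • ((z * x) * y) ∈ gradedRelIdeal R p := by
  induction hx using Submodule.span_induction with
  | zero => simp
  | add x x' _ _ h h' =>
    convert add_mem h h' using 1
    simp only [add_mul, mul_add]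
    module
  | smul r x _ h =>
    convert Submodule.smul_mem _ r h using 1
    simp only [smul_mul_assoc, mul_smul_comm]
    module
  | mem x hx =>
    obtain ⟨l, rfl, rfl⟩ := hx
    induction hy using Submodule.span_induction with
    | zero => simp
    | add x x' _ _ h h' =>
      convert add_mem h h' using 1
      simp only [add_mul, mul_add]
      module
    | smul r x _ h =>
      convert Submodule.smul_mem _ r h using 1
      simp only [smul_mul_assoc, mul_smul_comm]
      module
    | mem y hy =>
      obtain ⟨m, rfl, rfl⟩ := hy
      induction hz using Submodule.span_induction with
      | zero => simp
      | add x x' _ _ h h' =>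
        convert add_mem h h' using 1
        simp only [add_mul, mul_add]
        module
      | smul r x _ h =>
        convert Submodule.smul_mem _ r h using 1
        simp only [smul_mul_assoc, mul_smul_comm]
        module
      | mem z hz =>
        obtain ⟨n, rfl, rfl⟩ := hz
        have mulm := freeComponent_mul_mem k (genDegree (θ := θ) (𝔥 := 𝔥))
        have h1 := single_mem_freeComponent k (genParity (𝔥 := 𝔥) p) l
        have h2 := single_mem_freeComponent k (genParity (𝔥 := 𝔥) p) m
        have h3 := single_mem_freeComponent k (genParity (𝔥 := 𝔥) p) n
        have d1 := single_mem_freeComponent k (genDegree (θ := θ) (𝔥 := 𝔥)) l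
        have d2 := single_mem_freeComponent k (genDegree (θ := θ) (𝔥 := 𝔥)) m
        have d3 := single_mem_freeComponent k (genDegree (θ := θ) (𝔥 := 𝔥)) n
        refine mem_gradedRelIdeal_of_mem (relator_mem R p (Relator.jacobi _ _ _ _ _ _ h1 h2 h3))
          (add_mem (add_mem (mulm _ _ _ _ (mulm _ _ _ _ d1 d2) d3)
            (Submodule.smul_mem _ _ ?_)) (Submodule.smul_mem _ _ ?_))
        · rw [add_assoc, add_comm]
          exact mulm _ _ _ _ (mulm _ _ _ _ d2 d3) d1
        · rw [add_comm (_ + _), ← add_assoc]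
          exact mulm _ _ _ _ (mulm _ _ _ _ d3 d1) d2

theorem relator_mem_gradedRelIdeal {x : FreeAlg k θ 𝔥} (hx : Relator R p x) :
    x ∈ gradedRelIdeal R p := by
  have hm := relator_mem R p hx
  have mulm := freeComponent_mul_mem k (genDegree (θ := θ) (𝔥 := 𝔥))
  have hE : ∀ i : Fin θ, genE k 𝔥 i ∈ freeComponent k genDegree 1 :=
    fun i => of_mem_freeComponent k genDegree (Gen.e i)
  have hF : ∀ i : Fin θ, genF k 𝔥 i ∈ freeComponent k genDegree (-1) :=
    fun i => of_mem_freeComponent k genDegree (Gen.f i)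
  have hH : ∀ x : 𝔥, genH k θ x ∈ freeComponent k genDegree 0 :=
    fun x => of_mem_freeComponent k genDegree (Gen.h x)
  cases hx with
  | skew a b x y hx hy => exact skew_mem_gradedRelIdeal hx hy
  | jacobi a b c x y z hx hy hz => exact jacobi_mem_gradedRelIdeal hx hy hz
  | h_add x y => exact mem_gradedRelIdeal_of_mem hm (sub_mem (sub_mem (hH _) (hH _)) (hH _))
  | h_smul c x => exact mem_gradedRelIdeal_of_mem hm (sub_mem (hH _) (Submodule.smul_mem _ _ (hH _)))
  | h_h x y => exact mem_gradedRelIdeal_of_mem hm (mulm _ _ _ _ (hH x) (hH y))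
  | h_e x i =>
    have h := mulm _ _ _ _ (hH x) (hE i)
    rw [zero_add] at h
    exact mem_gradedRelIdeal_of_mem hm (sub_mem h (Submodule.smul_mem _ _ (hE i)))
  | h_f x i =>
    have h := mulm _ _ _ _ (hH x) (hF i)
    rw [zero_add] at h
    exact mem_gradedRelIdeal_of_mem hm (add_mem h (Submodule.smul_mem _ _ (hF i)))
  | e_f_same i =>
    exact mem_gradedRelIdeal_of_mem hm (sub_mem (mulm _ _ _ _ (hE i) (hF i)) (hH _))
  | e_f_ne i j hij => exact mem_gradedRelIdeal_of_mem hm (mulm _ _ _ _ (hE i) (hF j))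

/-- `gradedRelIdeal` contains the relators and is a two-sided ideal, since multiplication by a
monomial merely shifts weights; minimality of `relIdeal` does the rest. -/
theorem weightProj_mem_relIdeal {x : FreeAlg k θ 𝔥} (hx : x ∈ relIdeal R p) (n : ℤ) :
    weightProj k genDegree n x ∈ relIdeal R p := by
  suffices h : relIdeal R p ≤ gradedRelIdeal R p from (Submodule.mem_iInf _).1 (h hx) n
  refine sInf_le ⟨fun x hx => relator_mem_gradedRelIdeal hx, fun x y hy => ?_⟩
  have hy' := fun n => (Submodule.mem_iInf _).1 hy n
  simp only [Submodule.mem_comap] at hy'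
  induction x using MonoidAlgebra.induction_linear with
  | zero => simp
  | add x x' h h' =>
    rw [add_mul, mul_add]
    exact ⟨add_mem h.1 h'.1, add_mem h.2 h'.2⟩
  | single m c =>
    constructor
    · refine (Submodule.mem_iInf _).2 fun n => ?_
      rw [Submodule.mem_comap, weightProj_single_mul]
      exact (relIdeal_mul R p (hy' _) _).1
    · refine (Submodule.mem_iInf _).2 fun n => ?_
      rw [Submodule.mem_comap, weightProj_mul_single]
      exact (relIdeal_mul R p (hy' _) _).2

variable (R p) in
theorem disjoint_tildeDegree_zero :
    Disjoint (tildeDegree R p 0) (⨆ n : {n : ℤ // n ≠ 0}, tildeDegree R p n) := by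
  rw [Submodule.disjoint_def]
  rintro _ ⟨x, hx, rfl⟩ h
  simp only [tildeDegree] at h
  rw [← Submodule.map_iSup] at h
  obtain ⟨y, hy, e⟩ := h
  have h0 : ∀ y ∈ ⨆ n : {n : ℤ // n ≠ 0}, freeComponent k (genDegree (θ := θ) (𝔥 := 𝔥)) n,
      weightProj k genDegree 0 y = 0 := fun y hy => by
    have : ⨆ n : {n : ℤ // n ≠ 0}, freeComponent k (genDegree (θ := θ) (𝔥 := 𝔥)) n
        ≤ LinearMap.ker (weightProj k genDegree 0) := by
      refine iSup_le fun n z hz => ?_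
      rw [LinearMap.mem_ker, weightProj_of_mem k genDegree hz, if_neg n.2]
    exact this hy
  have h1 : y - x ∈ relIdeal R p := by
    rw [← Submodule.Quotient.mk_eq_zero, Submodule.Quotient.mk_sub, sub_eq_zero]
    exact e
  have h2 := weightProj_mem_relIdeal h1 0
  rw [map_sub, h0 y hy, weightProj_of_mem k genDegree hx, if_pos rfl, zero_sub,
    Submodule.neg_mem_iff] at h2
  exact (Submodule.Quotient.mk_eq_zero _).2 h2

end Contragredient

/-! ### Triangular decomposition of `𝔤̃(A, p)` and central elements of the radical. -/

namespace Contragredient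

open OperadicLieSuperalgebra

variable {k : Type u} [Field k] {θ : ℕ} {A : Matrix (Fin θ) (Fin θ) k}
  {𝔥 : Type w} [AddCommGroup 𝔥] [Module k 𝔥] (R : Realization A 𝔥) (p : Fin θ → ZMod 2)

/-- The image of a generator in `𝔤̃(A, p)`. -/
def tildeGen (g : Gen θ 𝔥) : Tilde R p := (relIdeal R p).mkQ (FreeNonUnitalNonAssocAlgebra.of k g)

/-- The image of a nonassociative word in the generators in `𝔤̃(A, p)`. -/
def tildeWord (m : FreeMagma (Gen θ 𝔥)) : Tilde R p :=
  (relIdeal R p).mkQ (MonoidAlgebra.single m 1)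

variable {R p}

theorem tildeWord_mul (m n : FreeMagma (Gen θ 𝔥)) :
    tildeWord R p (m * n) = (tilde R p).bracket (tildeWord R p m) (tildeWord R p n) := by
  have h : MonoidAlgebra.single (m * n) (1 : k)
      = MonoidAlgebra.single m 1 * MonoidAlgebra.single n 1 := by
    rw [MonoidAlgebra.single_mul_single, mul_one]
  rw [tildeWord, h]
  rfl

theorem mkQ_mem_grading {a : ZMod 2} {x : FreeAlg k θ 𝔥}
    (hx : x ∈ freeComponent k (genParity p) a) :
    (relIdeal R p).mkQ x ∈ (tilde R p).grading a := ⟨x, hx, rfl⟩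

theorem tildeWord_mem_grading (m : FreeMagma (Gen θ 𝔥)) :
    tildeWord R p m ∈ (tilde R p).grading (weight (genParity p) m) :=
  mkQ_mem_grading (single_mem_freeComponent k (genParity p) m)

theorem tildeWord_mem_tildeDegree (m : FreeMagma (Gen θ 𝔥)) :
    tildeWord R p m ∈ tildeDegree R p (weight genDegree m) :=
  ⟨_, single_mem_freeComponent k genDegree m, rfl⟩

theorem tildeGen_mem_grading (g : Gen θ 𝔥) :
    tildeGen R p g ∈ (tilde R p).grading (genParity p g) := tildeWord_mem_grading (.of g)

theorem tildeGen_mem_tildeDegree (g : Gen θ 𝔥) :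
    tildeGen R p g ∈ tildeDegree R p (genDegree g) := tildeWord_mem_tildeDegree (.of g)

theorem bracket_mem_tildeDegree (m n : ℤ) (x y : Tilde R p) (hx : x ∈ tildeDegree R p m)
    (hy : y ∈ tildeDegree R p n) : (tilde R p).bracket x y ∈ tildeDegree R p (m + n) := by
  obtain ⟨x, hx, rfl⟩ := hx
  obtain ⟨y, hy, rfl⟩ := hy
  exact ⟨x * y, freeComponent_mul_mem k genDegree m n x y hx hy, rfl⟩

theorem tildeCartan_le_grading : tildeCartan R p ≤ (tilde R p).grading 0 := by
  refine Submodule.span_le.2 ?_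
  rintro _ ⟨x, rfl⟩
  exact tildeGen_mem_grading (Gen.h x)

theorem tildeCartan_le_tildeDegree : tildeCartan R p ≤ tildeDegree R p 0 := by
  refine Submodule.span_le.2 ?_
  rintro _ ⟨x, rfl⟩
  exact tildeGen_mem_tildeDegree (Gen.h x)

theorem mkQ_eq_of_relator {x y : FreeAlg k θ 𝔥} (h : Relator R p (x - y)) :
    (relIdeal R p).mkQ x = (relIdeal R p).mkQ y :=
  (Submodule.Quotient.eq _).2 (relator_mem R p h)

theorem bracket_tildeCartan {x y : Tilde R p} (hx : x ∈ tildeCartan R p)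
    (hy : y ∈ tildeCartan R p) : (tilde R p).bracket x y = 0 := by
  refine (Submodule.mem_bot k).1 (apply_mem_of_mem_span ?_ hx hy)
  rintro _ ⟨x, rfl⟩ _ ⟨y, rfl⟩
  exact (Submodule.mem_bot k).2
    ((Submodule.Quotient.mk_eq_zero _).2 (relator_mem R p (Relator.h_h x y)))

theorem bracket_tildeCartan_e {x : Tilde R p} (hx : x ∈ tildeCartan R p) (i : Fin θ) :
    (tilde R p).bracket x (tildeGen R p (.e i))
      ∈ (tilde R p).bracketSpan fun i => tildeGen R p (.e i) := by
  refine apply_mem_of_mem_span ?_ hx (Submodule.mem_span_singleton_self (R := k) _)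
  rintro _ ⟨x, rfl⟩ _ rfl
  have h := mkQ_eq_of_relator (Relator.h_e (R := R) (p := p) x i)
  rw [map_smul] at h
  exact Set.mem_of_eq_of_mem h (Submodule.smul_mem _ _ (Submodule.subset_span (.of i)))

theorem bracket_tildeCartan_f {x : Tilde R p} (hx : x ∈ tildeCartan R p) (i : Fin θ) :
    (tilde R p).bracket x (tildeGen R p (.f i))
      ∈ (tilde R p).bracketSpan fun i => tildeGen R p (.f i) := by
  refine apply_mem_of_mem_span ?_ hx (Submodule.mem_span_singleton_self (R := k) _)
  rintro _ ⟨x, rfl⟩ _ rfl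
  have h := mkQ_eq_of_relator (R := R) (p := p) (x := genH k θ x * genF k 𝔥 i)
    (y := -(R.root i x • genF k 𝔥 i)) (by rw [sub_neg_eq_add]; exact Relator.h_f x i)
  rw [map_neg, map_smul] at h
  exact Set.mem_of_eq_of_mem h
    (neg_mem (Submodule.smul_mem _ _ (Submodule.subset_span (.of i))))

theorem bracket_e_f_mem_tildeCartan (i j : Fin θ) :
    (tilde R p).bracket (tildeGen R p (.e i)) (tildeGen R p (.f j)) ∈ tildeCartan R p := by
  by_cases hij : i = j
  · subst hij
    exact Set.mem_of_eq_of_mem (mkQ_eq_of_relator (Relator.e_f_same (R := R) (p := p) i))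
      (Submodule.subset_span ⟨R.coroot i, rfl⟩)
  · exact Set.mem_of_eq_of_mem
      ((Submodule.Quotient.mk_eq_zero _).2 (relator_mem R p (Relator.e_f_ne i j hij)))
      (zero_mem (tildeCartan R p))

theorem bracket_f_e_mem_tildeCartan (i j : Fin θ) :
    (tilde R p).bracket (tildeGen R p (.f i)) (tildeGen R p (.e j)) ∈ tildeCartan R p := by
  rw [bracket_comm (tildeGen_mem_grading _) (tildeGen_mem_grading _)]
  exact neg_mem (Submodule.smul_mem _ _ (bracket_e_f_mem_tildeCartan j i))

variable (R p)

/-- The sum of `𝔥` and the subalgebras generated by the `e_i` and by the `f_i`. -/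
def triangular : Submodule k (Tilde R p) :=
  (((tilde R p).bracketSpan fun i => tildeGen R p (.e i)) ⊔
    ((tilde R p).bracketSpan fun i => tildeGen R p (.f i))) ⊔ tildeCartan R p

variable {R p}

theorem tildeGen_e_mem_bracketSpan (i : Fin θ) :
    tildeGen R p (.e i) ∈ (tilde R p).bracketSpan fun i => tildeGen R p (.e i) :=
  Submodule.subset_span (.of i)

theorem tildeGen_f_mem_bracketSpan (i : Fin θ) :
    tildeGen R p (.f i) ∈ (tilde R p).bracketSpan fun i => tildeGen R p (.f i) :=
  Submodule.subset_span (.of i)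

theorem tildeGen_mem_triangular (g : Gen θ 𝔥) : tildeGen R p g ∈ triangular R p := by
  cases g with
  | e i => exact Submodule.mem_sup_left (Submodule.mem_sup_left (tildeGen_e_mem_bracketSpan i))
  | f i => exact Submodule.mem_sup_left (Submodule.mem_sup_right (tildeGen_f_mem_bracketSpan i))
  | h x => exact Submodule.mem_sup_right (Submodule.subset_span ⟨x, rfl⟩)

/-- Each generator is checked against each of the three summands; the only cases leaving a summand
are `f_i` on the `e`-part and `e_i` on the `f`-part, where `bracket_mem_bracketSpan_sup` adds a term
in `𝔥`, and `e_i` or `f_i` on `𝔥`. -/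
theorem bracket_tildeGen_mem_triangular (g : Gen θ 𝔥) {x : Tilde R p}
    (hx : x ∈ triangular R p) : (tilde R p).bracket (tildeGen R p g) x ∈ triangular R p := by
  have hE : ∀ i : Fin θ, ∃ a, tildeGen R p (.e i) ∈ (tilde R p).grading a :=
    fun i => ⟨_, tildeGen_mem_grading _⟩
  have hF : ∀ i : Fin θ, ∃ a, tildeGen R p (.f i) ∈ (tilde R p).grading a :=
    fun i => ⟨_, tildeGen_mem_grading _⟩
  have hH : ∀ x : 𝔥, tildeGen R p (.h x) ∈ tildeCartan R p :=
    fun x => Submodule.subset_span ⟨x, rfl⟩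
  have toE : ∀ z ∈ (tilde R p).bracketSpan fun i => tildeGen R p (.e i), z ∈ triangular R p :=
    fun z hz => Submodule.mem_sup_left (Submodule.mem_sup_left hz)
  have toF : ∀ z ∈ (tilde R p).bracketSpan fun i => tildeGen R p (.f i), z ∈ triangular R p :=
    fun z hz => Submodule.mem_sup_left (Submodule.mem_sup_right hz)
  obtain ⟨y, hy, c, hc, rfl⟩ := Submodule.mem_sup.1 hx
  obtain ⟨a, ha, b, hb, rfl⟩ := Submodule.mem_sup.1 hy
  rw [map_add, map_add]
  refine add_mem (add_mem ?_ ?_) ?_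
  · cases g with
    | e i => exact toE _ (bracket_mem_bracketSpan (tildeGen_e_mem_bracketSpan i) ha)
    | f i =>
      have h := bracket_mem_bracketSpan_sup hE tildeCartan_le_grading
        (fun _ => bracket_tildeCartan_e) (tildeGen_mem_grading (.f i))
        (bracket_f_e_mem_tildeCartan i) ha
      obtain ⟨s, hs, t, ht, e⟩ := Submodule.mem_sup.1 h
      rw [← e]
      exact add_mem (toE s hs) (Submodule.mem_sup_right ht)
    | h x =>
      exact toE _ (bracket_even_mem_bracketSpan hE (tildeCartan_le_grading (hH x))
        (bracket_tildeCartan_e (hH x)) ha)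
  · cases g with
    | e i =>
      have h := bracket_mem_bracketSpan_sup hF tildeCartan_le_grading
        (fun _ => bracket_tildeCartan_f) (tildeGen_mem_grading (.e i))
        (bracket_e_f_mem_tildeCartan i) hb
      obtain ⟨s, hs, t, ht, e⟩ := Submodule.mem_sup.1 h
      rw [← e]
      exact add_mem (toF s hs) (Submodule.mem_sup_right ht)
    | f i => exact toF _ (bracket_mem_bracketSpan (tildeGen_f_mem_bracketSpan i) hb)
    | h x =>
      exact toF _ (bracket_even_mem_bracketSpan hF (tildeCartan_le_grading (hH x))
        (bracket_tildeCartan_f (hH x)) hb)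
  · cases g with
    | e i =>
      rw [bracket_comm (tildeCartan_le_grading hc) (tildeGen_mem_grading _)]
      exact toE _ (neg_mem (Submodule.smul_mem _ _ (bracket_tildeCartan_e hc i)))
    | f i =>
      rw [bracket_comm (tildeCartan_le_grading hc) (tildeGen_mem_grading _)]
      exact toF _ (neg_mem (Submodule.smul_mem _ _ (bracket_tildeCartan_f hc i)))
    | h x =>
      rw [bracket_tildeCartan (hH x) hc]
      exact zero_mem _

theorem bracket_tildeWord_mem_triangular (m : FreeMagma (Gen θ 𝔥)) :
    ∀ x ∈ triangular R p, (tilde R p).bracket (tildeWord R p m) x ∈ triangular R p := by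
  induction m with
  | ih1 g => exact fun x hx => bracket_tildeGen_mem_triangular g hx
  | ih2 m n hm hn =>
    intro x hx
    rw [tildeWord_mul, eq_sub_of_add_eq
      (leibniz (tildeWord_mem_grading m) (tildeWord_mem_grading n) x).symm]
    exact sub_mem (hm _ (hn x hx)) (Submodule.smul_mem _ _ (hn _ (hm x hx)))

theorem tildeWord_mem_triangular (m : FreeMagma (Gen θ 𝔥)) :
    tildeWord R p m ∈ triangular R p := by
  induction m with
  | ih1 g => exact tildeGen_mem_triangular g
  | ih2 m n _ hn =>
    rw [tildeWord_mul]
    exact bracket_tildeWord_mem_triangular m _ hn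

theorem bracketSpan_le_iSup_tildeDegree {ι : Type*} {u : ι → Tilde R p} {S : ℤ → Prop}
    (hS : ∀ m n, S m → S n → S (m + n)) (h0 : ¬ S 0)
    (hu : ∀ i, ∃ n, S n ∧ u i ∈ tildeDegree R p n) :
    (tilde R p).bracketSpan u ≤ ⨆ n : {n : ℤ // n ≠ 0}, tildeDegree R p n := by
  refine Submodule.span_le.2 fun x hx => ?_
  obtain ⟨n, hn, hx⟩ := IsBracketWord.exists_mem_degree bracket_mem_tildeDegree hS hu hx
  exact Submodule.mem_iSup_of_mem ⟨n, fun h => h0 (h ▸ hn)⟩ hx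

/-- In the triangular decomposition the `e`-part has positive degrees and the `f`-part negative
ones. For a word of degree zero their sum also has degree zero, so it vanishes. -/
theorem tildeWord_mem_tildeCartan {m : FreeMagma (Gen θ 𝔥)} (hm : weight genDegree m = 0) :
    tildeWord R p m ∈ tildeCartan R p := by
  obtain ⟨y, hy, c, hc, e⟩ := Submodule.mem_sup.1 (tildeWord_mem_triangular (R := R) (p := p) m)
  have hy' : y ∈ ⨆ n : {n : ℤ // n ≠ 0}, tildeDegree R p n := by
    obtain ⟨s, hs, t, ht, rfl⟩ := Submodule.mem_sup.1 hy
    refine add_mem (?_ : s ∈ _) (?_ : t ∈ _)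
    · refine bracketSpan_le_iSup_tildeDegree (S := (0 < ·)) (fun _ _ => add_pos) (lt_irrefl 0)
        (fun i => ⟨1, one_pos, tildeGen_mem_tildeDegree (.e i)⟩) hs
    · refine bracketSpan_le_iSup_tildeDegree (S := (· < 0)) (fun _ _ => add_neg) (lt_irrefl 0)
        (fun i => ⟨-1, by decide, tildeGen_mem_tildeDegree (.f i)⟩) ht
  have hd := tildeWord_mem_tildeDegree (R := R) (p := p) m
  rw [hm] at hd
  have h0 : y ∈ tildeDegree R p 0 := by
    rw [eq_sub_of_add_eq e]
    exact sub_mem hd (tildeCartan_le_tildeDegree hc)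
  rw [← e, Submodule.disjoint_def.1 (disjoint_tildeDegree_zero R p) y h0 hy', zero_add]
  exact hc

/-- The line through a central bihomogeneous element is already an ideal, and in nonzero degree it
cannot meet `𝔥`, which sits in degree zero. -/
theorem mem_radical_of_central {a : ZMod 2} {n : ℤ} (hn : n ≠ 0) {z : Tilde R p}
    (hz : ∀ y, (tilde R p).bracket z y = 0) (ha : z ∈ (tilde R p).grading a)
    (hd : z ∈ tildeDegree R p n) : z ∈ radical R p := by
  refine le_sSup (a := Submodule.span k {z}) (s := trivialIdeals R p) ⟨⟨?_, ?_, ?_⟩, ?_, ?_⟩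
    (Submodule.mem_span_singleton_self z)
  · intro x y hy
    obtain ⟨c, rfl⟩ := Submodule.mem_span_singleton.1 hy
    have h0 := bracket_eq_zero_of_central ha hz x
    rw [map_smul, h0, smul_zero]
    exact zero_mem _
  · intro x y hy
    obtain ⟨c, rfl⟩ := Submodule.mem_span_singleton.1 hy
    rw [map_smul, LinearMap.smul_apply, hz, smul_zero]
    exact zero_mem _
  · have h01 : ∀ a : ZMod 2, a = 0 ∨ a = 1 := by decide
    rw [Submodule.span_singleton_le_iff_mem]
    rcases h01 a with rfl | rfl
    · exact Submodule.mem_sup_left ⟨Submodule.mem_span_singleton_self z, ha⟩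
    · exact Submodule.mem_sup_right ⟨Submodule.mem_span_singleton_self z, ha⟩
  · rw [Submodule.span_singleton_le_iff_mem]
    exact Submodule.mem_iSup_of_mem n ⟨Submodule.mem_span_singleton_self z, hd⟩
  · rw [← disjoint_iff, disjoint_comm]
    refine (disjoint_tildeDegree_zero R p).mono tildeCartan_le_tildeDegree ?_
    rw [Submodule.span_singleton_le_iff_mem]
    exact Submodule.mem_iSup_of_mem ⟨n, hn⟩ hd

/-- Additivity of `x ↦ [x, x]` reduces to monomials, which have a `ℤ`-degree while a general `x` of
given parity does not. -/
theorem bracket_self_mem_radical {a : ZMod 2} (ha : koszulSign k a a = 1)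
    {x : FreeAlg k θ 𝔥} (hx : x ∈ freeComponent k (genParity p) a) :
    (tilde R p).bracket ((relIdeal R p).mkQ x) ((relIdeal R p).mkQ x) ∈ radical R p := by
  induction hx using Submodule.span_induction with
  | zero => rw [map_zero, map_zero]; exact zero_mem _
  | add x y hx hy ihx ihy =>
    rw [map_add, bracket_self_add (mkQ_mem_grading hx) (mkQ_mem_grading hy) ha]
    exact add_mem ihx ihy
  | smul c x hx ihx =>
    rw [map_smul, map_smul, map_smul, LinearMap.smul_apply]
    exact Submodule.smul_mem _ _ (Submodule.smul_mem _ _ ihx)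
  | mem x hx =>
    obtain ⟨m, rfl, rfl⟩ := hx
    change (tilde R p).bracket (tildeWord R p m) (tildeWord R p m) ∈ radical R p
    have hm := tildeWord_mem_grading (R := R) (p := p) m
    by_cases h0 : weight genDegree m = 0
    · have hc := tildeWord_mem_tildeCartan (R := R) (p := p) h0
      rw [bracket_tildeCartan hc hc]
      exact zero_mem _
    · have hd := tildeWord_mem_tildeDegree (R := R) (p := p) m
      -- The degree is doubled in `ℤ`, so it stays nonzero whatever the characteristic of `k`.
      exact mem_radical_of_central (by omega) (bracket_self_bracket hm ha)
        ((tilde R p).bracket_mem _ _ _ _ hm hm) (bracket_mem_tildeDegree _ _ _ _ hd hd)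

theorem bracket_bracket_self_mem_radical {a : ZMod 2} (ha : koszulSign k a a ≠ 1)
    {x : FreeAlg k θ 𝔥} (hx : x ∈ freeComponent k (genParity p) a) :
    (tilde R p).bracket ((tilde R p).bracket ((relIdeal R p).mkQ x) ((relIdeal R p).mkQ x))
      ((relIdeal R p).mkQ x) ∈ radical R p := by
  have ha1 : a = 1 := by
    by_contra h
    exact ha (if_neg fun h' => h h'.1)
  induction hx using Submodule.span_induction with
  | zero => rw [map_zero, map_zero]; exact zero_mem _
  | add x y hx hy ihx ihy =>
    rw [map_add, bracket_bracket_self_add (mkQ_mem_grading hx) (mkQ_mem_grading hy)]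
    exact add_mem ihx ihy
  | smul c x hx ihx =>
    simp only [map_smul, LinearMap.smul_apply]
    exact Submodule.smul_mem _ _ (Submodule.smul_mem _ _ (Submodule.smul_mem _ _ ihx))
  | mem x hx =>
    obtain ⟨m, rfl, rfl⟩ := hx
    change (tilde R p).bracket ((tilde R p).bracket (tildeWord R p m) (tildeWord R p m))
      (tildeWord R p m) ∈ radical R p
    have hm := tildeWord_mem_grading (R := R) (p := p) m
    by_cases h0 : weight genDegree m = 0
    · have hc := tildeWord_mem_tildeCartan (R := R) (p := p) h0
      rw [bracket_tildeCartan hc hc, map_zero, LinearMap.zero_apply]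
      exact zero_mem _
    · have hd := tildeWord_mem_tildeDegree (R := R) (p := p) m
      exact mem_radical_of_central (by omega) (bracket_bracket_self_bracket hm ha)
        ((tilde R p).bracket_mem _ _ _ _ ((tilde R p).bracket_mem _ _ _ _ hm hm) hm)
        (bracket_mem_tildeDegree _ _ _ _ (bracket_mem_tildeDegree _ _ _ _ hd hd) hd)

variable (R p) in
theorem isStrict_contragredientLieSuperalgebra : (contragredientLieSuperalgebra R p).IsStrict where
  bracket_self := by
    rintro a _ ⟨_, ⟨x, hx, rfl⟩, rfl⟩ ha
    exact (Submodule.Quotient.mk_eq_zero _).2 (bracket_self_mem_radical ha hx)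
  bracket_bracket_self := by
    rintro a _ ⟨_, ⟨x, hx, rfl⟩, rfl⟩ ha
    exact (Submodule.Quotient.mk_eq_zero _).2 (bracket_bracket_self_mem_radical ha hx)

end Contragredient

end

/-- Contragredient Lie superalgebras are PBW in every characteristic. -/
theorem mainTheorem8 {k : Type u} [Field k] {θ : ℕ} (A : Matrix (Fin θ) (Fin θ) k)
    (p : Fin θ → ZMod 2) {𝔥 : Type w} [AddCommGroup 𝔥] [Module k 𝔥] (R : Realization A 𝔥) :
    (contragredientLieSuperalgebra R p).IsPBW :=
  (Contragredient.isStrict_contragredientLieSuperalgebra R p).isPBW
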